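/- Let $E,F$ be complex Banach lattices, i.e. complexifications of real Banach lattices $E_{\mathbb R},F_{\mathbb R}$ with modulus $|x+iy|=\sup_\theta(\cos\theta\,x+\sin\theta\,y)$ and norm $\|z\|=\|\,|z|\,\|$, and let $F_{\mathbb R}$ be Dedekind complete. A real $m$-homogeneous polynomial $P(x)=A(x,\dots,x)\colon E_{\mathbb R}\to F_{\mathbb R}$, $A$ symmetric $m$-linear, is *positive* if $A(x_1,\dots,x_m)\ge 0$ for all $x_1,\dots,x_m\ge 0$, and *regular* if it is a difference of two positive ones; the order on the regular polynomials is that given by positivity. A complex $m$-homogeneous polynomial $P\colon E\to F$ is regular if $P_0(x)=\operatorname{Re}P(x)$ and $P_1(x)=\operatorname{Im}P(x)$ ($x\in E_{\mathbb R}$) are regular; then $|P|=\sup_\theta(\cos\theta\,P_0+\sin\theta\,P_1)$ in the space of real regular $m$-homogeneous polynomials, and $\|P\|_r=\sup\{\|\,|P|(x)\|:x\in E_{\mathbb R},\ \|x\|\le 1\}$. Let $f\colon U\to F$ be holomorphic on an open set $U\subseteq E$, and let $P_m^{f,z}=\frac1{m!}\hat d^mf(z)$ be the $m$-th Taylor polynomial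 of $f$ at $z$. We say that $f$ is *regularly holomorphic at* $z$ if all $P_m^{f,z}$ are regular and $\limsup_m\|P_m^{f,z}\|_r^{1/m}<\infty$, and *regularly holomorphic on* $U$ if for every $z\in U$ all $P_m^{f,z}$ are regular and the Taylor series at $z$ is regularly convergent near $z$, i.e. $\sum_m|P_m^{f,z}|(|w-z|)$ converges for all $w$ in a neighbourhood of $z$. **Proposition.** Suppose that $f$ is regularly holomorphic at a point $z_0\in U$. Then $f$ is regularly holomorphic on some open neighbourhood $V\subseteq U$ of $z_0$, and at each point of $V$. More precisely, there are $C,\rho>0$ with $\|P_m^{f,z_0}\|_r\le C\rho^m$ for all $m\ge 0$, and for all such $C,\rho$, with $B$ the open ball with centre $z_0$ and radius $(2e\rho)^{-1}$: 1. if $B\subseteq U$, then $f$ is regularly holomorphic on $B$, and at each point of $B$; 2. in general, the Taylor series of $f$ at $z_0$ converges on $B$ to a function $g$ that is regularly holomorphic on $B$, and at each point of $B$, and $f=g$ on the connected component of $U\cap B$ that contains $z_0$. -/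

import Mathlib

open Set Filter Topology Metric
open scoped ENNReal

set_option linter.unusedSectionVars false

noncomputable section

/-! ### The complexification of a real Banach lattice

A real Banach lattice is a complete normed space `E` over `ℝ` with a compatible lattice order
and a solid norm.  The complex Banach lattice with real part `E` is the set of all `x + i y`
with `x, y ∈ E`, with the modulus `|x + i y| = sup_θ (cos θ x + sin θ y)` and the norm
`‖z‖ = ‖ |z| ‖`. -/

/-- The elements `re + i im` of the complexification of `E`. -/
@[ext]
structure Cplx (E : Type*) where
  re : E
  im : E

namespace Cplx

section Algebra

variable {E : Type*} [AddCommGroup E]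

/-! The vector space structure is the evident one. -/

instance : Zero (Cplx E) := ⟨⟨0, 0⟩⟩
instance : Add (Cplx E) := ⟨fun z w => ⟨z.re + w.re, z.im + w.im⟩⟩
instance : Neg (Cplx E) := ⟨fun z => ⟨-z.re, -z.im⟩⟩
instance : Sub (Cplx E) := ⟨fun z w => ⟨z.re - w.re, z.im - w.im⟩⟩

@[simp] theorem zero_re : (0 : Cplx E).re = 0 := rfl
@[simp] theorem zero_im : (0 : Cplx E).im = 0 := rfl
@[simp] theorem add_re (z w : Cplx E) : (z + w).re = z.re + w.re := rfl
@[simp] theorem add_im (z w : Cplx E) : (z + w).im = z.im + w.im := rfl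
@[simp] theorem neg_re (z : Cplx E) : (-z).re = -z.re := rfl
@[simp] theorem neg_im (z : Cplx E) : (-z).im = -z.im := rfl
@[simp] theorem sub_re (z w : Cplx E) : (z - w).re = z.re - w.re := rfl
@[simp] theorem sub_im (z w : Cplx E) : (z - w).im = z.im - w.im := rfl

instance : AddCommGroup (Cplx E) where
  add_assoc a b c := by ext <;> simp [add_assoc]
  zero_add a := by ext <;> simp
  add_zero a := by ext <;> simp
  add_comm a b := by ext <;> simp [add_comm]
  neg_add_cancel a := by ext <;> simp
  sub_eq_add_neg a b := by ext <;> simp [sub_eq_add_neg]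
  nsmul := nsmulRec
  zsmul := zsmulRec

/-- The inclusion `x ↦ x + i 0` of the real part. -/
def ofReal (x : E) : Cplx E := ⟨x, 0⟩

variable [Module ℝ E]

instance : SMul ℂ (Cplx E) :=
  ⟨fun c z => ⟨c.re • z.re - c.im • z.im, c.re • z.im + c.im • z.re⟩⟩

@[simp] theorem smul_re (c : ℂ) (z : Cplx E) : (c • z).re = c.re • z.re - c.im • z.im := rfl
@[simp] theorem smul_im (c : ℂ) (z : Cplx E) : (c • z).im = c.re • z.im + c.im • z.re := rfl

instance : Module ℂ (Cplx E) where
  one_smul z := by ext <;> simp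
  mul_smul a b z := by ext <;> simp <;> module
  smul_zero a := by ext <;> simp
  smul_add a z w := by ext <;> simp <;> module
  add_smul a b z := by ext <;> simp <;> module
  zero_smul z := by ext <;> simp

end Algebra

section Modulus

variable {E : Type*} [NormedAddCommGroup E] [NormedSpace ℝ E] [Lattice E] [HasSolidNorm E]
  [IsOrderedAddMonoid E] [IsOrderedModule ℝ E] [CompleteSpace E]

/-- The real part `cos θ x + sin θ y` of `e^{-iθ} (x + i y)`. -/
def rot (z : Cplx E) (θ : ℝ) : E := Real.cos θ • z.re + Real.sin θ • z.im

theorem smul_le_abs_smul (a : ℝ) (x : E) : a • x ≤ |a| • |x| := by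
  rcases le_total 0 a with h | h
  · rw [abs_of_nonneg h]; exact smul_le_smul_of_nonneg_left (le_abs_self x) h
  · rw [abs_of_nonpos h, ← neg_smul_neg]
    exact smul_le_smul_of_nonneg_left (neg_le_abs x) (by linarith)

theorem rot_le_rot_add (z : Cplx E) (θ η : ℝ) {δ : ℝ} (hc : |Real.cos θ - Real.cos η| ≤ δ)
    (hs : |Real.sin θ - Real.sin η| ≤ δ) :
    z.rot θ ≤ z.rot η + δ • (|z.re| + |z.im|) := by
  have h1 := (smul_le_abs_smul (Real.cos θ - Real.cos η) z.re).trans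
    (smul_le_smul_of_nonneg_right hc (abs_nonneg z.re))
  have h2 := (smul_le_abs_smul (Real.sin θ - Real.sin η) z.im).trans
    (smul_le_smul_of_nonneg_right hs (abs_nonneg z.im))
  have h3 := add_le_add h1 h2
  have h4 : z.rot θ = z.rot η + ((Real.cos θ - Real.cos η) • z.re +
      (Real.sin θ - Real.sin η) • z.im) := by
    simp only [rot]; module
  rw [h4, smul_add]
  gcongr

/-- In a Banach lattice the supremum defining the modulus exists: the suprema over finite sets of
angles converge in norm. -/
theorem exists_isLUB_rot (z : Cplx E) : ∃ a : E, IsLUB (range z.rot) a := by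
  classical
  let u : Finset ℝ → E := fun S => (insert 0 S).sup' (Finset.insert_nonempty 0 S) z.rot
  have hmono : Monotone u := fun S T h =>
    Finset.sup'_mono _ (Finset.insert_subset_insert 0 h) _
  have hub : ∀ b : E, (∀ S, u S ≤ b) ↔ ∀ θ, z.rot θ ≤ b := by
    intro b
    constructor
    · intro h θ
      exact (Finset.le_sup' z.rot (by simp : θ ∈ (insert 0 {θ} : Finset ℝ))).trans (h {θ})
    · intro h S
      exact Finset.sup'_le _ _ fun θ _ => h θ
  have hcauchy : CauchySeq u := by
    rw [Metric.cauchySeq_iff']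
    intro ε hε
    set c : E := |z.re| + |z.im| with hcdef
    have hc0 : 0 ≤ c := add_nonneg (abs_nonneg _) (abs_nonneg _)
    obtain ⟨δ, hδ, hδε⟩ : ∃ δ > 0, δ * ‖c‖ < ε := by
      refine ⟨ε / (‖c‖ + 1), by positivity, ?_⟩
      rw [div_mul_eq_mul_div, div_lt_iff₀ (by positivity)]
      nlinarith [norm_nonneg c]
    have htb : TotallyBounded (range fun θ : ℝ => (Real.cos θ, Real.sin θ)) := by
      refine (isCompact_closedBall (0 : ℝ × ℝ) 1).totallyBounded.subset ?_
      rintro _ ⟨θ, rfl⟩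
      simp [Prod.norm_def, Real.abs_cos_le_one, Real.abs_sin_le_one]
    obtain ⟨t, hts, htf, hcov⟩ := Metric.finite_approx_of_totallyBounded htb δ hδ
    obtain ⟨S, hS⟩ : ∃ S : Finset ℝ, ∀ p ∈ t, ∃ η ∈ S, (Real.cos η, Real.sin η) = p := by
      have hts' : ∀ p ∈ t, ∃ θ : ℝ, (Real.cos θ, Real.sin θ) = p := fun p hp => hts hp
      choose! g hg using hts'
      exact ⟨htf.toFinset.image g, fun p hp =>
        ⟨g p, Finset.mem_image_of_mem _ (htf.mem_toFinset.2 hp), hg p hp⟩⟩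
    have hnet : ∀ θ, z.rot θ ≤ u S + δ • c := by
      intro θ
      obtain ⟨p, hp, hθ⟩ := mem_iUnion₂.1 (hcov ⟨θ, rfl⟩)
      obtain ⟨η, hη, rfl⟩ := hS p hp
      rw [Metric.mem_ball, Prod.dist_eq, max_lt_iff, Real.dist_eq, Real.dist_eq] at hθ
      refine (rot_le_rot_add z θ η hθ.1.le hθ.2.le).trans ?_
      gcongr
      exact Finset.le_sup' z.rot (Finset.mem_insert_of_mem hη)
    refine ⟨S, fun T hT => ?_⟩
    have h1 : u S ≤ u T := hmono hT
    have h2 : u T ≤ u S + δ • c := Finset.sup'_le _ _ fun θ _ => hnet θ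
    rw [dist_eq_norm]
    refine lt_of_le_of_lt ?_ hδε
    have h3 : ‖u T - u S‖ ≤ ‖δ • c‖ := by
      apply norm_le_norm_of_abs_le_abs
      rw [abs_of_nonneg (sub_nonneg.2 h1), abs_of_nonneg (smul_nonneg hδ.le hc0)]
      exact sub_le_iff_le_add'.2 h2
    rwa [norm_smul, Real.norm_of_nonneg hδ.le] at h3
  obtain ⟨a, ha⟩ := cauchySeq_tendsto_of_complete hcauchy
  have hlub := isLUB_of_tendsto_atTop hmono ha
  refine ⟨a, ?_, ?_⟩
  · rintro _ ⟨θ, rfl⟩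
    exact (hub a).1 (fun S => hlub.1 ⟨S, rfl⟩) θ
  · intro b hb
    refine hlub.2 ?_
    rintro _ ⟨S, rfl⟩
    exact (hub b).2 (fun θ => hb ⟨θ, rfl⟩) S

/-- The modulus `|x + i y| = sup_θ (cos θ x + sin θ y)`, an element of the real part. -/
def modulus (z : Cplx E) : E := (exists_isLUB_rot z).choose

theorem isLUB_modulus (z : Cplx E) : IsLUB (range z.rot) z.modulus :=
  (exists_isLUB_rot z).choose_spec

theorem rot_le_modulus (z : Cplx E) (θ : ℝ) : z.rot θ ≤ z.modulus :=
  z.isLUB_modulus.1 ⟨θ, rfl⟩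

theorem modulus_le {z : Cplx E} {b : E} (h : ∀ θ, z.rot θ ≤ b) : z.modulus ≤ b :=
  z.isLUB_modulus.2 (by rintro _ ⟨θ, rfl⟩; exact h θ)

theorem abs_re_le (z : Cplx E) : |z.re| ≤ z.modulus := by
  refine abs_le'.2 ⟨?_, ?_⟩
  · simpa [rot] using z.rot_le_modulus 0
  · simpa [rot] using z.rot_le_modulus Real.pi

theorem abs_im_le (z : Cplx E) : |z.im| ≤ z.modulus := by
  refine abs_le'.2 ⟨?_, ?_⟩
  · simpa [rot] using z.rot_le_modulus (Real.pi / 2)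
  · simpa [rot] using z.rot_le_modulus (-(Real.pi / 2))

theorem modulus_nonneg (z : Cplx E) : 0 ≤ z.modulus := (abs_nonneg _).trans z.abs_re_le

theorem modulus_le_add (z : Cplx E) : z.modulus ≤ |z.re| + |z.im| := by
  refine modulus_le fun θ => add_le_add ?_ ?_
  · refine (smul_le_abs_smul _ _).trans ?_
    simpa using smul_le_smul_of_nonneg_right (Real.abs_cos_le_one θ) (abs_nonneg z.re)
  · refine (smul_le_abs_smul _ _).trans ?_
    simpa using smul_le_smul_of_nonneg_right (Real.abs_sin_le_one θ) (abs_nonneg z.im)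

theorem modulus_add_le (z w : Cplx E) : (z + w).modulus ≤ z.modulus + w.modulus := by
  refine modulus_le fun θ => ?_
  have h : (z + w).rot θ = z.rot θ + w.rot θ := by simp only [rot, add_re, add_im]; module
  rw [h]
  exact add_le_add (z.rot_le_modulus θ) (w.rot_le_modulus θ)

theorem modulus_smul_le (c : ℂ) (z : Cplx E) : (c • z).modulus ≤ ‖c‖ • z.modulus := by
  refine modulus_le fun θ => ?_
  have h : (c • z).rot θ = ‖c‖ • z.rot (θ - c.arg) := by
    simp only [rot, smul_re, smul_im, Real.cos_sub, Real.sin_sub]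
    have h1 : c.re = ‖c‖ * Real.cos c.arg := (Complex.norm_mul_cos_arg c).symm
    have h2 : c.im = ‖c‖ * Real.sin c.arg := (Complex.norm_mul_sin_arg c).symm
    rw [h1, h2]
    module
  rw [h]
  exact smul_le_smul_of_nonneg_left (z.rot_le_modulus _) (norm_nonneg c)

/-- The norm `‖z‖ = ‖ |z| ‖` of the complex Banach lattice. -/
instance : NormedAddCommGroup (Cplx E) :=
  AddGroupNorm.toNormedAddCommGroup
    { toFun := fun z => ‖z.modulus‖
      map_zero' := by
        have h : (0 : Cplx E).modulus = 0 :=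
          le_antisymm (by simpa using (0 : Cplx E).modulus_le_add) (modulus_nonneg _)
        simp [h]
      add_le' := fun z w => by
        refine le_trans (norm_le_norm_of_abs_le_abs ?_) (norm_add_le z.modulus w.modulus)
        rw [abs_of_nonneg (modulus_nonneg _),
          abs_of_nonneg (add_nonneg (modulus_nonneg _) (modulus_nonneg _))]
        exact modulus_add_le z w
      neg' := fun z => by
        have h : ∀ w : Cplx E, (-w).modulus ≤ w.modulus := fun w => by
          simpa using modulus_smul_le (-1) w
        rw [le_antisymm (h z) (by simpa using h (-z))]
      eq_zero_of_map_eq_zero' := fun z hz => by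
        have h0 : z.modulus = 0 := norm_eq_zero.1 hz
        have h1 := z.abs_re_le
        have h2 := z.abs_im_le
        rw [h0] at h1 h2
        ext
        · exact norm_eq_zero.1 (by rw [← norm_abs_eq_norm, le_antisymm h1 (abs_nonneg _), norm_zero])
        · exact norm_eq_zero.1 (by rw [← norm_abs_eq_norm, le_antisymm h2 (abs_nonneg _), norm_zero]) }

theorem norm_def (z : Cplx E) : ‖z‖ = ‖z.modulus‖ := rfl

instance : NormedSpace ℂ (Cplx E) where
  norm_smul_le c z := by
    have h : ‖(c • z).modulus‖ ≤ ‖‖c‖ • z.modulus‖ := by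
      apply norm_le_norm_of_abs_le_abs
      rw [abs_of_nonneg (modulus_nonneg _),
        abs_of_nonneg (smul_nonneg (norm_nonneg c) (modulus_nonneg _))]
      exact modulus_smul_le c z
    simpa [norm_smul, norm_def] using h

theorem norm_re_le (z : Cplx E) : ‖z.re‖ ≤ ‖z‖ :=
  norm_le_norm_of_abs_le_abs (by rw [abs_of_nonneg z.modulus_nonneg]; exact z.abs_re_le)

theorem norm_im_le (z : Cplx E) : ‖z.im‖ ≤ ‖z‖ :=
  norm_le_norm_of_abs_le_abs (by rw [abs_of_nonneg z.modulus_nonneg]; exact z.abs_im_le)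

theorem norm_le_add (z : Cplx E) : ‖z‖ ≤ ‖z.re‖ + ‖z.im‖ := by
  have h : ‖z.modulus‖ ≤ ‖|z.re| + |z.im|‖ := by
    apply norm_le_norm_of_abs_le_abs
    rw [abs_of_nonneg z.modulus_nonneg, abs_of_nonneg (add_nonneg (abs_nonneg _) (abs_nonneg _))]
    exact z.modulus_le_add
  refine h.trans ((norm_add_le _ _).trans ?_)
  simp [norm_abs_eq_norm]

theorem cauchySeq_re {u : ℕ → Cplx E} (hu : CauchySeq u) : CauchySeq fun n => (u n).re := by
  rw [Metric.cauchySeq_iff'] at hu ⊢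
  intro ε hε
  obtain ⟨N, hN⟩ := hu ε hε
  refine ⟨N, fun n hn => ?_⟩
  have h := hN n hn
  rw [dist_eq_norm] at h ⊢
  exact lt_of_le_of_lt (norm_re_le (u n - u N)) h

theorem cauchySeq_im {u : ℕ → Cplx E} (hu : CauchySeq u) : CauchySeq fun n => (u n).im := by
  rw [Metric.cauchySeq_iff'] at hu ⊢
  intro ε hε
  obtain ⟨N, hN⟩ := hu ε hε
  refine ⟨N, fun n hn => ?_⟩
  have h := hN n hn
  rw [dist_eq_norm] at h ⊢
  exact lt_of_le_of_lt (norm_im_le (u n - u N)) h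

theorem tendsto_of_re_im {u : ℕ → Cplx E} {c : Cplx E}
    (hre : Tendsto (fun n => (u n).re) atTop (𝓝 c.re))
    (him : Tendsto (fun n => (u n).im) atTop (𝓝 c.im)) : Tendsto u atTop (𝓝 c) := by
  rw [tendsto_iff_norm_sub_tendsto_zero] at hre him ⊢
  have h := hre.add him
  rw [add_zero] at h
  refine squeeze_zero (fun n => norm_nonneg _) (fun n => ?_) h
  simpa only [sub_re, sub_im] using norm_le_add (u n - c)

instance : CompleteSpace (Cplx E) :=
  Metric.complete_of_cauchySeq_tendsto fun u hu => by
    obtain ⟨a, ha⟩ := cauchySeq_tendsto_of_complete (cauchySeq_re hu)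
    obtain ⟨b, hb⟩ := cauchySeq_tendsto_of_complete (cauchySeq_im hu)
    exact ⟨⟨a, b⟩, tendsto_of_re_im (c := ⟨a, b⟩) ha hb⟩

end Modulus

end Cplx

/-! ### Dedekind completeness -/

/-- Every nonempty set that is bounded above has a least upper bound. -/
def IsDedekindComplete (F : Type*) [Preorder F] : Prop :=
  ∀ s : Set F, s.Nonempty → BddAbove s → ∃ a, IsLUB s a

/-! ### Regular homogeneous polynomials -/

section RealPolynomials

variable {E F : Type*} [AddCommGroup E] [Module ℝ E] [Lattice E]
  [AddCommGroup F] [Module ℝ F] [Lattice F]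

/-- `P : E → F` is a positive `m`-homogeneous polynomial: `P x = A (x, …, x)` where the symmetric
`m`-linear mapping `A` satisfies `A (x₁, …, x_m) ≥ 0` for all `x₁, …, x_m ≥ 0`. -/
def IsPositivePoly (m : ℕ) (P : E → F) : Prop :=
  ∃ A : MultilinearMap ℝ (fun _ : Fin m => E) F,
    (∀ (σ : Equiv.Perm (Fin m)) (v : Fin m → E), A (v ∘ σ) = A v) ∧
    (∀ v : Fin m → E, (∀ i, 0 ≤ v i) → 0 ≤ A v) ∧
    ∀ x, P x = A fun _ => x

/-- `P : E → F` is a regular `m`-homogeneous polynomial: a difference of two positive ones. -/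
def IsRegularRealPoly (m : ℕ) (P : E → F) : Prop :=
  ∃ Q R : E → F, IsPositivePoly m Q ∧ IsPositivePoly m R ∧ P = Q - R

/-- The order of the space of regular `m`-homogeneous polynomials. -/
def PolyLE (m : ℕ) (P Q : E → F) : Prop := IsPositivePoly m (Q - P)

end RealPolynomials

section ComplexPolynomials

variable {E F : Type*} [AddCommGroup E] [Module ℝ E] [Lattice E]
  [AddCommGroup F] [Module ℝ F] [Lattice F]

/-- `P` is a complex `m`-homogeneous polynomial: `P z = A (z, …, z)` for some symmetric complex
`m`-linear mapping `A`. -/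
def IsHomPoly (m : ℕ) (P : Cplx E → Cplx F) : Prop :=
  ∃ A : MultilinearMap ℂ (fun _ : Fin m => Cplx E) (Cplx F),
    (∀ (σ : Equiv.Perm (Fin m)) (v : Fin m → Cplx E), A (v ∘ σ) = A v) ∧
    ∀ z, P z = A fun _ => z

/-- The real polynomial `P₀` in `P = P₀ + i P₁`, given by `P₀ x = re (P x)` at real points. -/
def polyRe (P : Cplx E → Cplx F) (x : E) : F := (P (Cplx.ofReal x)).re

/-- The real polynomial `P₁` in `P = P₀ + i P₁`, given by `P₁ x = im (P x)` at real points. -/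
def polyIm (P : Cplx E → Cplx F) (x : E) : F := (P (Cplx.ofReal x)).im

/-- A complex `m`-homogeneous polynomial is regular if both its real and imaginary parts are. -/
def IsRegularPoly (m : ℕ) (P : Cplx E → Cplx F) : Prop :=
  IsHomPoly m P ∧ IsRegularRealPoly m (polyRe P) ∧ IsRegularRealPoly m (polyIm P)

/-- `Q = |P|`: in the ordered space of real regular `m`-homogeneous polynomials, `Q` is the least
upper bound of the polynomials `cos θ P₀ + sin θ P₁`, `θ ∈ ℝ`. -/
structure IsPolyModulus (m : ℕ) (P : Cplx E → Cplx F) (Q : E → F) : Prop where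
  regular : IsRegularRealPoly m Q
  upper : ∀ θ : ℝ, PolyLE m (Real.cos θ • polyRe P + Real.sin θ • polyIm P) Q
  least : ∀ R : E → F, IsRegularRealPoly m R →
    (∀ θ : ℝ, PolyLE m (Real.cos θ • polyRe P + Real.sin θ • polyIm P) R) → PolyLE m Q R

open Classical in
/-- The modulus `|P|` of a complex regular `m`-homogeneous polynomial `P`.  It exists when the
real part of the codomain is Dedekind complete, and it is unique. -/
def polyModulus (m : ℕ) (P : Cplx E → Cplx F) : E → F :=
  if h : ∃ Q, IsPolyModulus m P Q then h.choose else 0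

end ComplexPolynomials

/-- The regular norm `‖P‖_r = ‖ |P| ‖`, where `‖ ‖` is the supremum norm over the unit ball; it is
given the value `∞` if the supremum is infinite. -/
def regNorm {E F : Type*} [NormedAddCommGroup E] [NormedSpace ℝ E] [Lattice E]
    [NormedAddCommGroup F] [NormedSpace ℝ F] [Lattice F]
    (m : ℕ) (P : Cplx E → Cplx F) : ℝ≥0∞ :=
  ⨆ x : E, ⨆ _ : ‖x‖ ≤ 1, ‖polyModulus m P x‖ₑ

/-! ### Regularly holomorphic mappings -/

section Holomorphic

variable {E F : Type*}
  [NormedAddCommGroup E] [NormedSpace ℝ E] [Lattice E] [HasSolidNorm E]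
  [IsOrderedAddMonoid E] [IsOrderedModule ℝ E] [CompleteSpace E]
  [NormedAddCommGroup F] [NormedSpace ℝ F] [Lattice F] [HasSolidNorm F]
  [IsOrderedAddMonoid F] [IsOrderedModule ℝ F] [CompleteSpace F]

/-- The `m`-th term `w ↦ (1 / m!) d^m f(z) (w, …, w)` of the Taylor series of `f` at `z`. -/
def taylorPoly (m : ℕ) (f : Cplx E → Cplx F) (z w : Cplx E) : Cplx F :=
  ((m.factorial : ℂ)⁻¹) • iteratedFDeriv ℂ m f z fun _ => w

/-- `f` is regularly holomorphic at the point `z`. -/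
def RegularlyHolomorphicAt (f : Cplx E → Cplx F) (z : Cplx E) : Prop :=
  (∀ m, IsRegularPoly m (taylorPoly m f z)) ∧
    limsup (fun m : ℕ => regNorm m (taylorPoly m f z) ^ (1 / (m : ℝ))) atTop < ∞

/-- `f` is regularly holomorphic on the open set `U`: it is holomorphic on `U`, and for every
`z ∈ U` the terms of its Taylor series at `z` are regular and the series is regularly convergent
in some neighbourhood of `z`. -/
structure RegularlyHolomorphicOn (f : Cplx E → Cplx F) (U : Set (Cplx E)) : Prop where
  holomorphic : AnalyticOnNhd ℂ f U
  regular : ∀ z ∈ U, ∀ m, IsRegularPoly m (taylorPoly m f z)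
  convergent : ∀ z ∈ U, ∀ᶠ w in 𝓝 z,
    Summable fun m : ℕ => polyModulus m (taylorPoly m f z) (w - z).modulus

end Holomorphic

end

/-! The Taylor coefficients at `z₀` are majorised by one real power series, and this majorisation
survives a change of origin. If a regular polynomial P has the symmetric complex mapping A, then |P|
is the diagonal of a symmetric real mapping B with cos θ Re A(v) + sin θ Im A(v) ≤ B(v) for all θ
and all v ≥ 0 (`IsDominatedBy`). Inequalities of polynomials become inequalities of symmetric
mappings because these are determined by their diagonals (`ext_of_diag`). The modulus exists by the
Riesz–Kantorovich theorem, applied to one variable at a time by currying.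

Such a B is positive, which gives two estimates. Expanding B(∑ vᵢ) for vᵢ ≥ 0 shows n! B(v) ≤ B(∑
vᵢ, …, ∑ vᵢ), so polarization costs at most nⁿ/n! ≤ eⁿ (`norm_apply_le_of_diag`). Expanding A in
real and imaginary parts shows |A(z)| ≤ B(|Re z| + |Im z|) (`modulus_apply_le`), where the new
argument has norm at most 2‖z‖. Hence a bound C ρ^m on the regular norms makes the real series
converge for norms below 1/(eρ) and the complex one for norms below 1/(2eρ).

Let ‖a‖ < 1/(2eρ). Recentring the complex series at a and the real one at |Re a| + |Im a| preserves
domination term by term (`isDominatedBy_changeOrigin`); the real centre has norm less than 1/(eρ),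
so both recentrings are legitimate. The coefficients at `z₀` + a are therefore regular, and their
moduli are bounded by the coefficients of a convergent real series, hence geometrically. This
settles the sum g of the Taylor series; the identity theorem carries the result over to f. -/

/-! ### Suprema of order bounded sets of linear mappings -/

section LinearSup

variable {E G : Type*} [AddCommGroup E] [Module ℝ E] [Lattice E] [IsOrderedAddMonoid E]
  [IsOrderedModule ℝ E] [AddCommGroup G] [Module ℝ G] [PartialOrder G] [IsOrderedAddMonoid G]
  [IsOrderedModule ℝ G]

/-- The Riesz decomposition property. -/
theorem riesz_decomposition {z₁ z₂ x y : E} (hz₁ : 0 ≤ z₁) (hz₂ : 0 ≤ z₂) (hx : 0 ≤ x)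
    (hy : 0 ≤ y) (h : z₁ + z₂ = x + y) :
    ∃ x₁ y₁ x₂ y₂ : E, 0 ≤ x₁ ∧ 0 ≤ y₁ ∧ 0 ≤ x₂ ∧ 0 ≤ y₂ ∧
      z₁ = x₁ + y₁ ∧ z₂ = x₂ + y₂ ∧ x = x₁ + x₂ ∧ y = y₁ + y₂ := by
  have h1 : x - z₂ = z₁ - y := by rw [sub_eq_sub_iff_add_eq_add, ← h]
  have h2 : x - z₂ ≤ z₁ ⊓ x := by
    refine le_inf ?_ (sub_le_self _ hz₂)
    rw [h1]
    exact sub_le_self _ hy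
  -- The first piece takes as much of x as fits under z₁, and the equations force the other three.
  -- Positivity of the last piece is exactly x - z₂ ≤ z₁ ⊓ x.
  refine ⟨z₁ ⊓ x, z₁ - z₁ ⊓ x, x - z₁ ⊓ x, z₂ - (x - z₁ ⊓ x), le_inf hz₁ hx,
    sub_nonneg.2 inf_le_left, sub_nonneg.2 inf_le_right, ?_, by abel, by abel, by abel, ?_⟩
  · rw [sub_nonneg, sub_le_comm]
    exact h2
  · have : y = z₁ + z₂ - x := by rw [h]; abel
    rw [this]
    abel

/-- `SumDecomp S x g` means that `g = ∑ Tᵢ xᵢ` for some `Tᵢ ∈ S` and some decomposition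
`x = ∑ xᵢ` into positive elements. -/
inductive SumDecomp (S : Set (E →ₗ[ℝ] G)) : E → G → Prop
  | single {T : E →ₗ[ℝ] G} {x : E} : T ∈ S → 0 ≤ x → SumDecomp S x (T x)
  | add {x y : E} {g h : G} : SumDecomp S x g → SumDecomp S y h → SumDecomp S (x + y) (g + h)

namespace SumDecomp

variable {S : Set (E →ₗ[ℝ] G)}

theorem nonneg {x : E} {g : G} (h : SumDecomp S x g) : 0 ≤ x := by
  induction h with
  | single _ hx => exact hx
  | add _ _ h1 h2 => exact add_nonneg h1 h2

theorem le {R : E →ₗ[ℝ] G} (hR : ∀ T ∈ S, ∀ x, 0 ≤ x → T x ≤ R x) {x : E} {g : G}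
    (h : SumDecomp S x g) : g ≤ R x := by
  induction h with
  | single hT hx => exact hR _ hT _ hx
  | add _ _ h1 h2 => rw [map_add]; exact add_le_add h1 h2

theorem smul {c : ℝ} (hc : 0 ≤ c) {x : E} {g : G} (h : SumDecomp S x g) :
    SumDecomp S (c • x) (c • g) := by
  induction h with
  | single hT hx => rw [← map_smul]; exact single hT (smul_nonneg hc hx)
  | add _ _ h1 h2 => rw [smul_add, smul_add]; exact add h1 h2

/-- Riesz decomposition at each sum refines a decomposition of x + y into one of x and one of y.
This is what makes the supremum in `exists_linearMap_isLUB` subadditive. -/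
theorem split {z : E} {g : G} (h : SumDecomp S z g) {x y : E} (hx : 0 ≤ x) (hy : 0 ≤ y)
    (hz : z = x + y) : ∃ g₁ g₂, SumDecomp S x g₁ ∧ SumDecomp S y g₂ ∧ g = g₁ + g₂ := by
  induction h generalizing x y with
  | @single T z hT _ => exact ⟨T x, T y, single hT hx, single hT hy, by rw [hz, map_add]⟩
  | add h1 h2 ih1 ih2 =>
    obtain ⟨x₁, y₁, x₂, y₂, hx₁, hy₁, hx₂, hy₂, e1, e2, rfl, rfl⟩ :=
      riesz_decomposition h1.nonneg h2.nonneg hx hy hz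
    obtain ⟨a, b, ha, hb, rfl⟩ := ih1 hx₁ hy₁ e1
    obtain ⟨c, d, hc, hd, rfl⟩ := ih2 hx₂ hy₂ e2
    exact ⟨a + c, b + d, ha.add hc, hb.add hd, by abel⟩

end SumDecomp

/-- An additive and positively homogeneous mapping on the positive cone extends to a linear
mapping. -/
theorem exists_linearMap_eq_on_cone (t : E → G)
    (hadd : ∀ x y, 0 ≤ x → 0 ≤ y → t (x + y) = t x + t y)
    (hsmul : ∀ (c : ℝ) x, 0 < c → 0 ≤ x → t (c • x) = c • t x) :
    ∃ T : E →ₗ[ℝ] G, ∀ x, 0 ≤ x → T x = t x := by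
  -- The value t x⁺ - t x⁻ is the same for every way of writing x as a difference of positive
  -- elements; linearity follows by choosing convenient ones.
  have key : ∀ x u v : E, 0 ≤ u → 0 ≤ v → x = u - v → t x⁺ - t x⁻ = t u - t v := by
    intro x u v hu hv hx
    have h : x⁺ + v = u + x⁻ := by
      have := posPart_sub_negPart x
      rw [hx] at this ⊢
      rw [← sub_eq_zero] at this ⊢
      rw [← this]
      abel
    have h' := congrArg t h
    rw [hadd _ _ (posPart_nonneg x) hv, hadd _ _ hu (negPart_nonneg x)] at h'
    rw [sub_eq_sub_iff_add_eq_add, h']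
  have hP := fun x : E => posPart_nonneg x
  have hN := fun x : E => negPart_nonneg x
  have h0 : t 0 = 0 := by simpa using hadd 0 0 le_rfl le_rfl
  refine ⟨{ toFun := fun x => t x⁺ - t x⁻, map_add' := ?_, map_smul' := ?_ }, fun x hx => ?_⟩
  · intro x y
    rw [key (x + y) (x⁺ + y⁺) (x⁻ + y⁻) (add_nonneg (hP x) (hP y)) (add_nonneg (hN x) (hN y)),
      hadd _ _ (hP x) (hP y), hadd _ _ (hN x) (hN y)]
    · abel
    · conv_lhs => rw [← posPart_sub_negPart x, ← posPart_sub_negPart y]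
      abel
  · intro c x
    simp only [RingHom.id_apply]
    rcases lt_trichotomy c 0 with hc | rfl | hc
    · have hc' : 0 < -c := neg_pos.2 hc
      rw [key (c • x) ((-c) • x⁻) ((-c) • x⁺) (smul_nonneg hc'.le (hN x))
        (smul_nonneg hc'.le (hP x)), hsmul _ _ hc' (hN x), hsmul _ _ hc' (hP x)]
      · module
      · conv_lhs => rw [← posPart_sub_negPart x]
        module
    · simp
    · rw [key (c • x) (c • x⁺) (c • x⁻) (smul_nonneg hc.le (hP x)) (smul_nonneg hc.le (hN x)),
        hsmul _ _ hc (hP x), hsmul _ _ hc (hN x), smul_sub]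
      rw [← smul_sub, posPart_sub_negPart]
  · simpa [h0] using key x x 0 hx le_rfl (by simp)

/-- The Riesz–Kantorovich theorem: a nonempty set of linear mappings into a Dedekind complete
space that is bounded above has a least upper bound. -/
theorem exists_linearMap_isLUB (hG : IsDedekindComplete G) {S : Set (E →ₗ[ℝ] G)}
    (hS : S.Nonempty) {M : E →ₗ[ℝ] G} (hM : ∀ T ∈ S, ∀ x, 0 ≤ x → T x ≤ M x) :
    ∃ T : E →ₗ[ℝ] G, (∀ L ∈ S, ∀ x, 0 ≤ x → L x ≤ T x) ∧
      ∀ R : E →ₗ[ℝ] G, (∀ L ∈ S, ∀ x, 0 ≤ x → L x ≤ R x) → ∀ x, 0 ≤ x → T x ≤ R x := by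
  obtain ⟨L₀, hL₀⟩ := hS
  -- The supremum at x runs over all sums ∑ Tᵢ xᵢ with x = ∑ xᵢ, since the pointwise supremum of the
  -- T x need not be additive. Off the cone the value is irrelevant.
  have hex : ∀ x : E, ∃ a, 0 ≤ x → IsLUB {g | SumDecomp S x g} a := by
    intro x
    by_cases hx : 0 ≤ x
    · obtain ⟨a, ha⟩ := hG {g | SumDecomp S x g} ⟨L₀ x, .single hL₀ hx⟩
        ⟨M x, fun g hg => SumDecomp.le hM hg⟩
      exact ⟨a, fun _ => ha⟩
    · exact ⟨0, fun h => absurd h hx⟩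
  choose t ht using hex
  obtain ⟨T, hT⟩ := exists_linearMap_eq_on_cone t
    (by
      intro x y hx hy
      apply le_antisymm
      · refine (ht _ (add_nonneg hx hy)).2 fun g hg => ?_
        obtain ⟨g₁, g₂, h1, h2, rfl⟩ := SumDecomp.split hg hx hy rfl
        exact add_le_add ((ht x hx).1 h1) ((ht y hy).1 h2)
      · rw [← le_sub_iff_add_le]
        refine (ht x hx).2 fun g hg => ?_
        rw [le_sub_comm]
        refine (ht y hy).2 fun h hh => ?_
        rw [le_sub_iff_add_le, add_comm]
        exact (ht _ (add_nonneg hx hy)).1 (hg.add hh))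
    (by
      intro c x hc hx
      apply le_antisymm
      · refine (ht _ (smul_nonneg hc.le hx)).2 fun g hg => ?_
        have h := (ht x hx).1 (show SumDecomp S x (c⁻¹ • g) by
          simpa [smul_smul, hc.ne'] using SumDecomp.smul (inv_nonneg.2 hc.le) hg)
        simpa [smul_smul, hc.ne'] using smul_le_smul_of_nonneg_left h hc.le
      · have h : t x ≤ c⁻¹ • t (c • x) := by
          refine (ht x hx).2 fun g hg => ?_
          have h := (ht _ (smul_nonneg hc.le hx)).1 (SumDecomp.smul hc.le hg)
          simpa [smul_smul, hc.ne'] using smul_le_smul_of_nonneg_left h (inv_nonneg.2 hc.le)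
        simpa [smul_smul, hc.ne'] using smul_le_smul_of_nonneg_left h hc.le)
  refine ⟨T, fun L hL x hx => ?_, fun R hR x hx => ?_⟩
  · rw [hT x hx]
    exact (ht x hx).1 (.single hL hx)
  · rw [hT x hx]
    exact (ht x hx).2 fun g hg => SumDecomp.le hR hg

end LinearSup

/-! ### Algebra of multilinear mappings on vector lattices -/

section MultilinearAlgebra

variable {E G : Type*} [AddCommGroup E] [Module ℝ E] [AddCommGroup G] [Module ℝ G] {n : ℕ}

namespace MultilinearMap

section

variable [Lattice E] [IsOrderedAddMonoid E]

/-- Expanding vᵢ = vᵢ⁺ - vᵢ⁻ in each slot reduces arbitrary vectors to positive ones, up to signs.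
`apply_abs_eq_sum` has the same terms without the signs, so the two can be compared term by term. -/
theorem apply_eq_sum_posPart_negPart (A : MultilinearMap ℝ (fun _ : Fin n => E) G)
    (v : Fin n → E) :
    A v = ∑ s : Finset (Fin n), (∏ i, if i ∈ s then (1 : ℝ) else -1) •
      A (s.piecewise (fun i => (v i)⁺) fun i => (v i)⁻) := by
  have hv : v = (fun i => (v i)⁺) + fun i => -(v i)⁻ := by
    ext i
    simp [← sub_eq_add_neg]
  conv_lhs => rw [hv, A.map_add_univ]
  refine Finset.sum_congr rfl fun s _ => ?_
  rw [← A.map_smul_univ]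
  congr 1
  ext i
  by_cases hi : i ∈ s <;> simp [hi]

theorem piecewise_parts_nonneg (s : Finset (Fin n)) (v : Fin n → E) (i : Fin n) :
    0 ≤ s.piecewise (fun i => (v i)⁺) (fun i => (v i)⁻) i := by
  by_cases hi : i ∈ s
  · simp [hi]
  · simp [hi]

theorem ext_of_nonneg {A B : MultilinearMap ℝ (fun _ : Fin n => E) G}
    (h : ∀ v : Fin n → E, (∀ i, 0 ≤ v i) → A v = B v) : A = B := by
  ext v
  rw [A.apply_eq_sum_posPart_negPart, B.apply_eq_sum_posPart_negPart]
  refine Finset.sum_congr rfl fun s _ => ?_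
  rw [h _ (piecewise_parts_nonneg s v)]

theorem apply_abs_eq_sum (B : MultilinearMap ℝ (fun _ : Fin n => E) G) (v : Fin n → E) :
    B (fun i => |v i|) =
      ∑ s : Finset (Fin n), B (s.piecewise (fun i => (v i)⁺) fun i => (v i)⁻) := by
  rw [← B.map_add_univ]
  congr 1
  ext i
  exact (posPart_add_negPart (v i)).symm

/-- If `±A ≤ B` on the positive cone, then `|A v| ≤ B |v|`. -/
theorem abs_apply_le [Lattice G] [IsOrderedAddMonoid G]
    {A B : MultilinearMap ℝ (fun _ : Fin n => E) G}
    (h : ∀ v : Fin n → E, (∀ i, 0 ≤ v i) → |A v| ≤ B v) (v : Fin n → E) :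
    |A v| ≤ B fun i => |v i| := by
  rw [A.apply_eq_sum_posPart_negPart, B.apply_abs_eq_sum]
  refine (Finset.le_sum_of_subadditive (fun x : G => |x|) abs_zero.le abs_add_le _ _).trans ?_
  refine Finset.sum_le_sum fun s _ => ?_
  refine le_trans (le_of_eq ?_) (h _ (piecewise_parts_nonneg s v))
  have hc : (∏ i, if i ∈ s then (1 : ℝ) else -1) = 1 ∨
      (∏ i, if i ∈ s then (1 : ℝ) else -1) = -1 := by
    refine Finset.prod_induction _ (fun c : ℝ => c = 1 ∨ c = -1) ?_ (Or.inl rfl) ?_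
    · rintro a b (rfl | rfl) (rfl | rfl) <;> simp
    · intro i _
      by_cases hi : i ∈ s <;> simp [hi]
  rcases hc with hc | hc <;> simp [hc, abs_neg]

variable [PartialOrder G]

/-- The order of multilinear mappings: `A ≤ B` if `A v ≤ B v` for all `v` with positive entries. -/
instance conePartialOrder : PartialOrder (MultilinearMap ℝ (fun _ : Fin n => E) G) where
  le A B := ∀ v : Fin n → E, (∀ i, 0 ≤ v i) → A v ≤ B v
  le_refl _ _ _ := le_rfl
  le_trans _ _ _ h1 h2 v hv := (h1 v hv).trans (h2 v hv)
  le_antisymm _ _ h1 h2 := ext_of_nonneg fun v hv => le_antisymm (h1 v hv) (h2 v hv)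

instance [IsOrderedAddMonoid G] :
    IsOrderedAddMonoid (MultilinearMap ℝ (fun _ : Fin n => E) G) where
  add_le_add_left _ _ h C v hv := add_le_add_left (h v hv) (C v)

instance [IsOrderedModule ℝ G] :
    IsOrderedModule ℝ (MultilinearMap ℝ (fun _ : Fin n => E) G) where
  smul_le_smul_of_nonneg_left _ ha _ _ h v hv := smul_le_smul_of_nonneg_left (h v hv) ha
  smul_le_smul_of_nonneg_right _ hA _ _ h v hv := smul_le_smul_of_nonneg_right h (hA v hv)

/-- The multilinear mappings into a Dedekind complete space form a Dedekind complete space. -/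
theorem isDedekindComplete [IsOrderedModule ℝ E] [IsOrderedAddMonoid G] [IsOrderedModule ℝ G]
    (hG : IsDedekindComplete G) :
    IsDedekindComplete (MultilinearMap ℝ (fun _ : Fin n => E) G) := by
  induction n with
  | zero =>
    rintro S ⟨A, hA⟩ ⟨M, hM⟩
    obtain ⟨a, ha⟩ := hG ((fun A => A Fin.elim0) '' S) ⟨_, A, hA, rfl⟩
      ⟨M Fin.elim0, by rintro _ ⟨B, hB, rfl⟩; exact hM hB _ fun i => i.elim0⟩
    refine ⟨constOfIsEmpty ℝ _ a, fun B hB v hv => ?_, fun R hR v hv => ?_⟩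
    · rw [Subsingleton.elim v Fin.elim0]
      exact ha.1 ⟨B, hB, rfl⟩
    · rw [Subsingleton.elim v Fin.elim0]
      refine ha.2 ?_
      rintro _ ⟨B, hB, rfl⟩
      exact hR hB _ fun i => i.elim0
  | succ n ih =>
    rintro S ⟨A, hA⟩ ⟨M, hM⟩
    have hcons : ∀ (x : E) (v : Fin n → E), 0 ≤ x → (∀ i, 0 ≤ v i) →
        ∀ i, 0 ≤ (Fin.cons x v : Fin (n + 1) → E) i := by
      intro x v hx hv i
      refine Fin.cases ?_ (fun j => ?_) i
      · simpa using hx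
      · simpa using hv j
    -- Currying identifies the order with that of linear mappings from E into mappings of n
    -- variables. The latter are Dedekind complete by induction, and `exists_linearMap_isLUB` does
    -- not need its codomain to be a lattice.
    have hcurry : ∀ {B C : MultilinearMap ℝ (fun _ : Fin (n + 1) => E) G},
        B ≤ C ↔ ∀ x, 0 ≤ x → B.curryLeft x ≤ C.curryLeft x := by
      intro B C
      constructor
      · intro h x hx v hv
        simpa using h _ (hcons x v hx hv)
      · intro h v hv
        simpa using h (v 0) (hv 0) (Fin.tail v) fun i => hv i.succ
    obtain ⟨T, hT, hT'⟩ := exists_linearMap_isLUB ih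
      (S := (fun B : MultilinearMap ℝ (fun _ : Fin (n + 1) => E) G => B.curryLeft) '' S)
      ⟨_, A, hA, rfl⟩ (M := M.curryLeft)
      (by rintro _ ⟨B, hB, rfl⟩; exact hcurry.1 (hM hB))
    refine ⟨T.uncurryLeft, fun B hB => ?_, fun R hR => ?_⟩
    · rw [hcurry, LinearMap.curry_uncurryLeft]
      exact hT _ ⟨B, hB, rfl⟩
    · rw [hcurry, LinearMap.curry_uncurryLeft]
      refine hT' _ ?_
      rintro _ ⟨B, hB, rfl⟩
      exact hcurry.1 (hR hB)

end

/-! ### Polarization -/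

/-- A symmetric multilinear mapping that vanishes on the diagonal is zero. -/
theorem eq_zero_of_diag_eq_zero {A : MultilinearMap ℝ (fun _ : Fin n => E) G}
    (hsymm : ∀ (σ : Equiv.Perm (Fin n)) (v : Fin n → E), A (v ∘ σ) = A v)
    (h : ∀ x, A (fun _ => x) = 0) : A = 0 := by
  classical
  ext v
  have h1 : ∀ t : Finset (Fin n), A (fun _ => ∑ i ∈ tᶜ, v i) =
      ∑ r : Fin n → Fin n, if t ⊆ (Finset.univ.image r)ᶜ then A (v ∘ r) else 0 := by
    intro t
    rw [A.map_sum_finset (fun _ j => v j) fun _ => tᶜ, ← Finset.sum_filter]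
    refine Finset.sum_congr ?_ fun r _ => rfl
    ext r
    simp only [Fintype.mem_piFinset, Finset.mem_compl, Finset.mem_filter, Finset.mem_univ,
      true_and, Finset.subset_iff, Finset.mem_image, not_exists]
    exact ⟨fun h x hx a ha => h a (ha ▸ hx), fun h a ha => h ha a rfl⟩
  -- The polarization sum, evaluated in two ways: it vanishes by hypothesis, while
  -- inclusion–exclusion over the indices missed by r leaves only surjective r. These are
  -- permutations, each contributing A v by symmetry.
  have h2 : ∑ t : Finset (Fin n), (-1 : ℤ) ^ t.card • A (fun _ => ∑ i ∈ tᶜ, v i) = 0 :=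
    Finset.sum_eq_zero fun t _ => by rw [h, smul_zero]
  simp only [h1, Finset.smul_sum] at h2
  rw [Finset.sum_comm] at h2
  have h3 : ∀ r : Fin n → Fin n, (∑ t : Finset (Fin n), (-1 : ℤ) ^ t.card •
      if t ⊆ (Finset.univ.image r)ᶜ then A (v ∘ r) else 0) =
      if Function.Surjective r then A v else 0 := by
    intro r
    have h4 : (∑ t : Finset (Fin n), (-1 : ℤ) ^ t.card •
      if t ⊆ (Finset.univ.image r)ᶜ then A (v ∘ r) else 0) =
        (∑ t ∈ (Finset.univ.image r)ᶜ.powerset, (-1 : ℤ) ^ t.card) • A (v ∘ r) := by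
      rw [Finset.sum_smul]
      simp only [smul_ite, smul_zero]
      rw [← Finset.sum_filter]
      refine Finset.sum_congr ?_ fun _ _ => rfl
      ext t
      simp
    rw [h4, Finset.sum_powerset_neg_one_pow_card]
    by_cases hr : Function.Surjective r
    · have hb : Function.Bijective r := Finite.surjective_iff_bijective.1 hr
      rw [if_pos, if_pos hr, one_smul]
      · exact hsymm (Equiv.ofBijective r hb) v
      · simp [Finset.image_univ_of_surjective hr]
    · rw [if_neg, if_neg hr, zero_smul]
      intro h
      rw [Finset.compl_eq_empty_iff] at h
      refine hr fun j => ?_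
      obtain ⟨i, -, hi⟩ := Finset.mem_image.1 (h.ge (Finset.mem_univ j))
      exact ⟨i, hi⟩
  simp only [h3] at h2
  rw [← Finset.sum_filter, Finset.sum_const, ← Nat.cast_smul_eq_nsmul ℝ, smul_eq_zero] at h2
  refine h2.resolve_left ?_
  refine Nat.cast_ne_zero.2 (Finset.card_ne_zero.2 ?_)
  exact ⟨id, by simp [Function.surjective_id]⟩

/-- A symmetric multilinear mapping is determined by its values on the diagonal. -/
theorem ext_of_diag {A B : MultilinearMap ℝ (fun _ : Fin n => E) G}
    (hA : ∀ (σ : Equiv.Perm (Fin n)) (v : Fin n → E), A (v ∘ σ) = A v)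
    (hB : ∀ (σ : Equiv.Perm (Fin n)) (v : Fin n → E), B (v ∘ σ) = B v)
    (h : ∀ x, A (fun _ => x) = B fun _ => x) : A = B := by
  rw [← sub_eq_zero]
  refine eq_zero_of_diag_eq_zero (fun σ v => ?_) fun x => ?_
  · rw [sub_apply, sub_apply, hA, hB]
  · rw [sub_apply, h, sub_self]

/-- The expansion of A (∑ vᵢ, …, ∑ vᵢ) runs over all maps of the index set into itself, with
nonnegative terms; keeping only the permutations leaves n! copies of A v. -/
theorem factorial_smul_le [Lattice E] [IsOrderedAddMonoid E] [PartialOrder G]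
    [IsOrderedAddMonoid G] {A : MultilinearMap ℝ (fun _ : Fin n => E) G}
    (hsymm : ∀ (σ : Equiv.Perm (Fin n)) (v : Fin n → E), A (v ∘ σ) = A v)
    (hpos : ∀ v : Fin n → E, (∀ i, 0 ≤ v i) → 0 ≤ A v) {v : Fin n → E} (hv : ∀ i, 0 ≤ v i) :
    (n.factorial : ℝ) • A v ≤ A fun _ => ∑ i, v i := by
  classical
  rw [A.map_sum fun _ j => v j]
  let e : Equiv.Perm (Fin n) ↪ (Fin n → Fin n) := ⟨fun σ => σ, DFunLike.coe_injective⟩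
  have h1 : ∑ r ∈ Finset.univ.map e, A (fun i => v (r i)) = (n.factorial : ℝ) • A v := by
    rw [Finset.sum_map]
    have : ∀ σ : Equiv.Perm (Fin n), A (fun i => v (e σ i)) = A v := fun σ => hsymm σ v
    simp only [this, Finset.sum_const, Finset.card_univ, Fintype.card_perm, Fintype.card_fin]
    rw [Nat.cast_smul_eq_nsmul]
  rw [← h1]
  exact Finset.sum_le_sum_of_subset_of_nonneg (Finset.subset_univ _)
    fun r _ _ => hpos _ fun i => hv _

end MultilinearMap

end MultilinearAlgebra

/-! ### Positive polynomials and moduli of complex polynomials -/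

section PositivePolynomials

variable {E F : Type*} [AddCommGroup E] [Module ℝ E] [Lattice E] [IsOrderedAddMonoid E]
  [AddCommGroup F] [Module ℝ F] [Lattice F] [IsOrderedAddMonoid F] [IsOrderedModule ℝ F] {n : ℕ}

/-- The diagonal of a positive multilinear mapping, symmetric or not, is a positive polynomial. -/
theorem isPositivePoly_diag {A : MultilinearMap ℝ (fun _ : Fin n => E) F} (hA : 0 ≤ A) :
    IsPositivePoly n fun x => A fun _ => x := by
  have happly : ∀ v, ((n.factorial : ℝ)⁻¹ • ∑ σ : Equiv.Perm (Fin n), A.domDomCongr σ) v =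
      (n.factorial : ℝ)⁻¹ • ∑ σ : Equiv.Perm (Fin n), A (v ∘ σ) := fun v => by
    rw [_root_.smul_apply, _root_.sum_apply]
    rfl
  -- Averaging over permutations keeps positivity and the diagonal.
  refine ⟨(n.factorial : ℝ)⁻¹ • ∑ σ : Equiv.Perm (Fin n), A.domDomCongr σ, fun τ v => ?_,
    fun v hv => ?_, fun x => ?_⟩
  · rw [happly, happly]
    congr 1
    rw [← Equiv.sum_comp (Equiv.mulLeft τ) fun σ : Equiv.Perm (Fin n) => A (v ∘ σ)]
    rfl
  · rw [happly]
    exact smul_nonneg (by positivity) (Finset.sum_nonneg fun σ _ => hA _ fun i => hv _)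
  · rw [happly]
    have : ∀ σ : Equiv.Perm (Fin n), A ((fun _ : Fin n => x) ∘ σ) = A fun _ => x := fun σ => rfl
    simp only [this, Finset.sum_const, Finset.card_univ, Fintype.card_perm, Fintype.card_fin]
    rw [← Nat.cast_smul_eq_nsmul ℝ, smul_smul, inv_mul_cancel₀, one_smul]
    exact_mod_cast n.factorial_ne_zero

theorem polyLE_diag {A B : MultilinearMap ℝ (fun _ : Fin n => E) F} (h : A ≤ B) :
    PolyLE n (fun x => A fun _ => x) fun x => B fun _ => x :=
  isPositivePoly_diag (A := B - A) (sub_nonneg.2 h)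

end PositivePolynomials

/-! ### Domination and the modulus of a complex polynomial -/

section Modulus

variable {E F : Type*} [AddCommGroup E] [Module ℝ E] [Lattice E] [IsOrderedAddMonoid E]
  [AddCommGroup F] [Module ℝ F] [Lattice F] [IsOrderedAddMonoid F] [IsOrderedModule ℝ F] {n : ℕ}

namespace MultilinearMap

/-- The real multilinear mapping `v ↦ cos θ re (A v) + sin θ im (A v)` on real vectors `v`. -/
noncomputable def realRot (A : MultilinearMap ℂ (fun _ : Fin n => Cplx E) (Cplx F)) (θ : ℝ) :
    MultilinearMap ℝ (fun _ : Fin n => E) F where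
  toFun v := Real.cos θ • (A fun i => Cplx.ofReal (v i)).re +
    Real.sin θ • (A fun i => Cplx.ofReal (v i)).im
  map_update_add' := by
    intro _ v i x y
    have hu : ∀ z : E, (fun j => Cplx.ofReal (Function.update v i z j)) =
        Function.update (fun j => Cplx.ofReal (v j)) i (Cplx.ofReal z) := fun z => by
      ext1 j
      by_cases hj : j = i
      · subst hj; simp
      · simp [hj]
    have hadd : Cplx.ofReal (x + y) = Cplx.ofReal x + Cplx.ofReal y := by
      ext <;> simp [Cplx.ofReal]
    rw [hu, hu, hu, hadd, A.map_update_add, Cplx.add_re, Cplx.add_im]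
    module
  map_update_smul' := by
    intro _ v i c x
    have hu : ∀ z : E, (fun j => Cplx.ofReal (Function.update v i z j)) =
        Function.update (fun j => Cplx.ofReal (v j)) i (Cplx.ofReal z) := fun z => by
      ext1 j
      by_cases hj : j = i
      · subst hj; simp
      · simp [hj]
    have hsmul : Cplx.ofReal (c • x) = (c : ℂ) • Cplx.ofReal x := by
      ext <;> simp only [Cplx.ofReal, Cplx.smul_re, Cplx.smul_im, Complex.ofReal_re,
        Complex.ofReal_im, smul_zero, zero_smul, sub_zero, add_zero]
    rw [hu, hu, hsmul, A.map_update_smul, Cplx.smul_re, Cplx.smul_im]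
    simp only [Complex.ofReal_re, Complex.ofReal_im]
    module

theorem realRot_apply (A : MultilinearMap ℂ (fun _ : Fin n => Cplx E) (Cplx F)) (θ : ℝ)
    (v : Fin n → E) : A.realRot θ v = Real.cos θ • (A fun i => Cplx.ofReal (v i)).re +
      Real.sin θ • (A fun i => Cplx.ofReal (v i)).im := rfl

theorem realRot_symm {A : MultilinearMap ℂ (fun _ : Fin n => Cplx E) (Cplx F)}
    (hA : ∀ (σ : Equiv.Perm (Fin n)) (v : Fin n → Cplx E), A (v ∘ σ) = A v) (θ : ℝ)
    (σ : Equiv.Perm (Fin n)) (v : Fin n → E) : A.realRot θ (v ∘ σ) = A.realRot θ v := by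
  simp only [realRot_apply]
  rw [show (fun i => Cplx.ofReal ((v ∘ σ) i)) = (fun i => Cplx.ofReal (v i)) ∘ σ from rfl, hA]

/-- The family of rotations is closed under negation, so domination bounds absolute values. -/
theorem realRot_add_pi (A : MultilinearMap ℂ (fun _ : Fin n => Cplx E) (Cplx F)) (θ : ℝ) :
    A.realRot (θ + Real.pi) = -A.realRot θ := by
  ext v
  rw [neg_apply, realRot_apply, realRot_apply, Real.cos_add_pi, Real.sin_add_pi]
  module

theorem realRot_diag {A : MultilinearMap ℂ (fun _ : Fin n => Cplx E) (Cplx F)}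
    {P : Cplx E → Cplx F} (hP : ∀ z, P z = A fun _ => z) (θ : ℝ) :
    Real.cos θ • polyRe P + Real.sin θ • polyIm P = fun x => A.realRot θ fun _ => x := by
  ext x
  simp [polyRe, polyIm, hP, realRot_apply]

/-- `B` dominates `A` if `cos θ re (A v) + sin θ im (A v) ≤ B v` for all `θ` and all positive
vectors `v`. -/
def IsDominatedBy (A : MultilinearMap ℂ (fun _ : Fin n => Cplx E) (Cplx F))
    (B : MultilinearMap ℝ (fun _ : Fin n => E) F) : Prop :=
  ∀ θ, A.realRot θ ≤ B

theorem nonneg_of_le_of_neg_le {A B : MultilinearMap ℝ (fun _ : Fin n => E) F} (h1 : A ≤ B)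
    (h2 : -A ≤ B) : 0 ≤ B := fun v hv =>
  le_trans (abs_nonneg (A v)) (abs_le'.2 ⟨h1 v hv, h2 v hv⟩)

namespace IsDominatedBy

variable {A : MultilinearMap ℂ (fun _ : Fin n => Cplx E) (Cplx F)}
  {B : MultilinearMap ℝ (fun _ : Fin n => E) F}

theorem neg_le (h : A.IsDominatedBy B) (θ : ℝ) : -A.realRot θ ≤ B := by
  rw [← A.realRot_add_pi]
  exact h _

theorem nonneg (h : A.IsDominatedBy B) : 0 ≤ B := nonneg_of_le_of_neg_le (h 0) (h.neg_le 0)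

theorem isRegularRealPoly (h : A.IsDominatedBy B) (θ : ℝ) :
    IsRegularRealPoly n fun x => A.realRot θ fun _ => x :=
  ⟨fun x => B fun _ => x, fun x => (B - A.realRot θ) fun _ => x, isPositivePoly_diag h.nonneg,
    isPositivePoly_diag (sub_nonneg.2 (h θ)), by ext x; simp⟩

theorem isRegularPoly (h : A.IsDominatedBy B)
    {P : Cplx E → Cplx F} (hhom : IsHomPoly n P) (hP : ∀ z, P z = A fun _ => z) :
    IsRegularPoly n P := by
  refine ⟨hhom, ?_, ?_⟩
  · simpa [← realRot_diag hP] using h.isRegularRealPoly 0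
  · simpa [← realRot_diag hP] using h.isRegularRealPoly (Real.pi / 2)

theorem isRegularRealPoly_right (h : A.IsDominatedBy B) :
    IsRegularRealPoly n fun x => B fun _ => x :=
  ⟨fun x => B fun _ => x, fun x => (0 : MultilinearMap ℝ (fun _ : Fin n => E) F) fun _ => x,
    isPositivePoly_diag h.nonneg, isPositivePoly_diag le_rfl, by ext x; simp⟩

theorem polyLE_of_isPolyModulus (h : A.IsDominatedBy B) {P : Cplx E → Cplx F}
    (hP : ∀ z, P z = A fun _ => z) {Q : E → F} (hQ : IsPolyModulus n P Q) :
    PolyLE n Q fun x => B fun _ => x :=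
  hQ.least _ h.isRegularRealPoly_right fun θ => by
    rw [realRot_diag hP]
    exact polyLE_diag (h θ)

end IsDominatedBy

end MultilinearMap

open MultilinearMap

theorem IsRegularRealPoly.exists_multilinear {P : E → F} (hP : IsRegularRealPoly n P) :
    ∃ A M : MultilinearMap ℝ (fun _ : Fin n => E) F,
      (∀ (σ : Equiv.Perm (Fin n)) (v : Fin n → E), A (v ∘ σ) = A v) ∧ 0 ≤ M ∧ A ≤ M ∧ -A ≤ M ∧
      ∀ x, P x = A fun _ => x := by
  obtain ⟨Q, R, ⟨A, hA, hA0, hQ⟩, ⟨B, hB, hB0, hR⟩, rfl⟩ := hP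
  refine ⟨A - B, A + B, fun σ v => by simp only [_root_.sub_apply, hA, hB],
    fun v hv => add_nonneg (hA0 v hv) (hB0 v hv), fun v hv => ?_, fun v hv => ?_,
    fun x => by simp [hQ, hR]⟩
  · simp only [_root_.sub_apply, _root_.add_apply]
    exact (sub_le_self _ (hB0 v hv)).trans (le_add_of_nonneg_right (hB0 v hv))
  · rw [_root_.neg_apply]
    simp only [_root_.sub_apply, _root_.add_apply, neg_sub]
    exact (sub_le_self _ (hA0 v hv)).trans (le_add_of_nonneg_left (hA0 v hv))

/-- Since |cos θ| and |sin θ| are at most 1, majorants of ± the real and of ± the imaginary part add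
up to a bound for all θ. Only the existence of some bound matters: it feeds Dedekind completeness.
-/
theorem exists_isDominatedBy {P : Cplx E → Cplx F} (hP : IsRegularPoly n P)
    {A : MultilinearMap ℂ (fun _ : Fin n => Cplx E) (Cplx F)}
    (hA : ∀ (σ : Equiv.Perm (Fin n)) (v : Fin n → Cplx E), A (v ∘ σ) = A v)
    (hPA : ∀ z, P z = A fun _ => z) :
    ∃ B : MultilinearMap ℝ (fun _ : Fin n => E) F, A.IsDominatedBy B := by
  obtain ⟨-, hre, him⟩ := hP
  obtain ⟨A₀, M₀, hA₀, h0, h1, h2, e0⟩ := hre.exists_multilinear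
  obtain ⟨A₁, M₁, hA₁, h0', h1', h2', e1⟩ := him.exists_multilinear
  refine ⟨M₀ + M₁, fun θ v hv => ?_⟩
  have hθ : A.realRot θ = Real.cos θ • A₀ + Real.sin θ • A₁ := by
    refine ext_of_diag (realRot_symm hA θ) (fun σ v => ?_) fun x => ?_
    · simp only [_root_.add_apply, _root_.smul_apply, hA₀, hA₁]
    · simp only [_root_.add_apply, _root_.smul_apply, ← e0, ← e1, polyRe, polyIm,
        realRot_apply, hPA]
  have key : ∀ (c : ℝ) (x y : F), |c| ≤ 1 → x ≤ y → -x ≤ y → c • x ≤ y := by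
    intro c x y hc hx hx'
    have hy : |x| ≤ y := abs_le'.2 ⟨hx, hx'⟩
    rcases le_total 0 c with h | h
    · calc c • x ≤ c • |x| := smul_le_smul_of_nonneg_left (le_abs_self x) h
        _ ≤ (1 : ℝ) • |x| := smul_le_smul_of_nonneg_right ((le_abs_self c).trans hc) (abs_nonneg x)
        _ ≤ y := by rwa [one_smul]
    · calc c • x = (-c) • (-x) := by module
        _ ≤ (-c) • |x| := smul_le_smul_of_nonneg_left (neg_le_abs x) (neg_nonneg.2 h)
        _ ≤ (1 : ℝ) • |x| := smul_le_smul_of_nonneg_right ((neg_le_abs c).trans hc) (abs_nonneg x)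
        _ ≤ y := by rwa [one_smul]
  rw [hθ]
  exact add_le_add (key _ _ _ (Real.abs_cos_le_one θ) (h1 v hv) (h2 v hv))
    (key _ _ _ (Real.abs_sin_le_one θ) (h1' v hv) (h2' v hv))

/-- The modulus of a regular polynomial with values in a Dedekind complete space exists. -/
theorem IsRegularPoly.isPolyModulus_polyModulus [IsOrderedModule ℝ E] (hF : IsDedekindComplete F)
    {P : Cplx E → Cplx F} (hP : IsRegularPoly n P) : IsPolyModulus n P (polyModulus n P) := by
  suffices h : ∃ Q, IsPolyModulus n P Q by
    rw [polyModulus, dif_pos h]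
    exact h.choose_spec
  obtain ⟨A, hA, hPA⟩ := hP.1
  obtain ⟨M, hM⟩ := exists_isDominatedBy hP hA hPA
  -- The supremum is taken among all multilinear mappings. Its symmetry is not needed, because
  -- `isPositivePoly_diag` symmetrizes.
  obtain ⟨T, hT⟩ := MultilinearMap.isDedekindComplete hF (range A.realRot) ⟨_, 0, rfl⟩
    ⟨M, by rintro _ ⟨θ, rfl⟩; exact hM θ⟩
  have hdom : A.IsDominatedBy T := fun θ => hT.1 ⟨θ, rfl⟩
  refine ⟨fun x => T fun _ => x, hdom.isRegularRealPoly_right, fun θ => ?_, fun R hR hle => ?_⟩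
  · rw [realRot_diag hPA]
    exact polyLE_diag (hdom θ)
  · obtain ⟨B, -, hB, -, -, -, hRB⟩ := hR.exists_multilinear
    have hTB : T ≤ B := by
      refine hT.2 ?_
      rintro _ ⟨θ, rfl⟩
      obtain ⟨C, hC, hC0, hCd⟩ := hle θ
      have : C = B - A.realRot θ := by
        refine ext_of_diag hC (fun σ v => ?_) fun x => ?_
        · simp only [_root_.sub_apply, hB, realRot_symm hA]
        · rw [← hCd, realRot_diag hPA, Pi.sub_apply, hRB, _root_.sub_apply]
      intro v hv
      have h := hC0 v hv
      rwa [this, _root_.sub_apply, sub_nonneg] at h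
    have hRB' : R = fun x => B fun _ => x := funext hRB
    rw [hRB']
    exact polyLE_diag hTB

/-- The modulus of a polynomial comes from a symmetric multilinear mapping that dominates the
symmetric multilinear mapping of the polynomial. -/
theorem IsPolyModulus.exists_multilinear {P : Cplx E → Cplx F} {Q : E → F}
    (hQ : IsPolyModulus n P Q) {A : MultilinearMap ℂ (fun _ : Fin n => Cplx E) (Cplx F)}
    (hA : ∀ (σ : Equiv.Perm (Fin n)) (v : Fin n → Cplx E), A (v ∘ σ) = A v)
    (hPA : ∀ z, P z = A fun _ => z) :
    ∃ B : MultilinearMap ℝ (fun _ : Fin n => E) F,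
      (∀ (σ : Equiv.Perm (Fin n)) (v : Fin n → E), B (v ∘ σ) = B v) ∧ A.IsDominatedBy B ∧
      ∀ x, Q x = B fun _ => x := by
  obtain ⟨B, -, hB, -, -, -, hQB⟩ := hQ.regular.exists_multilinear
  refine ⟨B, hB, fun θ => ?_, hQB⟩
  obtain ⟨C, hC, hC0, hCd⟩ := hQ.upper θ
  have : C = B - A.realRot θ := by
    refine ext_of_diag hC (fun σ v => ?_) fun x => ?_
    · simp only [_root_.sub_apply, hB, realRot_symm hA]
    · rw [← hCd, realRot_diag hPA, Pi.sub_apply, hQB, _root_.sub_apply]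
  intro v hv
  have h := hC0 v hv
  rwa [this, _root_.sub_apply, sub_nonneg] at h

end Modulus

/-! ### Norm estimates -/

section NormEstimates

variable {E F : Type*}
  [NormedAddCommGroup E] [NormedSpace ℝ E] [Lattice E] [HasSolidNorm E]
  [IsOrderedAddMonoid E] [IsOrderedModule ℝ E] [CompleteSpace E]
  [NormedAddCommGroup F] [NormedSpace ℝ F] [Lattice F] [HasSolidNorm F]
  [IsOrderedAddMonoid F] [IsOrderedModule ℝ F] [CompleteSpace F] {n : ℕ}

theorem norm_le_norm_of_nonneg_of_le {a b : F} (ha : 0 ≤ a) (h : a ≤ b) : ‖a‖ ≤ ‖b‖ :=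
  norm_le_norm_of_abs_le_abs (by rwa [abs_of_nonneg ha, abs_of_nonneg (ha.trans h)])

theorem norm_le_norm_of_abs_le {a b : F} (h : |a| ≤ b) : ‖a‖ ≤ ‖b‖ :=
  norm_le_norm_of_abs_le_abs (h.trans (le_abs_self b))

namespace MultilinearMap

theorem mono_of_nonneg {B : MultilinearMap ℝ (fun _ : Fin n => E) F} (hB : 0 ≤ B)
    {v w : Fin n → E} (hv : ∀ i, 0 ≤ v i) (hvw : ∀ i, v i ≤ w i) : B v ≤ B w := by
  have hw : w = v + (w - v) := by abel
  rw [hw, B.map_add_univ]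
  have hnn : ∀ s : Finset (Fin n), 0 ≤ B (s.piecewise v (w - v)) := fun s => hB _ fun i => by
    by_cases hi : i ∈ s
    · simpa [hi] using hv i
    · simpa [hi] using hvw i
  simpa using Finset.single_le_sum (fun s _ => hnn s) (Finset.mem_univ Finset.univ)

theorem abs_apply_le_of_nonneg {B : MultilinearMap ℝ (fun _ : Fin n => E) F} (hB : 0 ≤ B)
    (v : Fin n → E) : |B v| ≤ B fun i => |v i| :=
  abs_apply_le (fun w hw => (abs_of_nonneg (hB w hw)).le) v

/-- A positive homogeneous polynomial on a Banach lattice is bounded on the unit ball. -/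
theorem exists_bound_diag {B : MultilinearMap ℝ (fun _ : Fin n => E) F} (hB : 0 ≤ B) :
    ∃ K : ℝ, ∀ x : E, ‖x‖ ≤ 1 → ‖B fun _ => x‖ ≤ K := by
  by_contra! hcon
  -- If B were unbounded, choose x k in the unit ball with ‖B (x k, …)‖ > k 2^(kn). The sum of the
  -- 2^(-k) |x k| dominates each summand, so by monotonicity the value of B there would have norm at
  -- least k for every k.
  choose x hx hBx using fun k : ℕ => hcon (k * (2 ^ k) ^ n)
  let u : ℕ → E := fun k => ((1 / 2 : ℝ) ^ k) • |x k|
  have hu0 : ∀ k, 0 ≤ u k := fun k => smul_nonneg (by positivity) (abs_nonneg _)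
  have husum : Summable u := by
    refine Summable.of_norm_bounded summable_geometric_two fun k => ?_
    rw [norm_smul, norm_abs_eq_norm, Real.norm_of_nonneg (by positivity)]
    exact mul_le_of_le_one_right (by positivity) (hx k)
  have key : ∀ k : ℕ, (k : ℝ) ≤ ‖B fun _ => ∑' j, u j‖ := by
    intro k
    have h1 : B (fun _ => u k) = (((1 / 2 : ℝ) ^ k) ^ n) • B fun _ => |x k| := by
      have := B.map_smul_univ (fun _ => (1 / 2 : ℝ) ^ k) fun _ => |x k|
      simpa only [Finset.prod_const, Finset.card_univ, Fintype.card_fin] using this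
    have h2 : ‖B fun _ => u k‖ ≤ ‖B fun _ => ∑' j, u j‖ :=
      norm_le_norm_of_nonneg_of_le (hB _ fun _ => hu0 k)
        (mono_of_nonneg hB (fun _ => hu0 k) fun _ => husum.le_tsum k fun j _ => hu0 j)
    refine le_trans ?_ h2
    have h3 : ‖B fun _ => x k‖ ≤ ‖B fun _ => |x k|‖ :=
      norm_le_norm_of_abs_le (abs_apply_le_of_nonneg hB fun _ => x k)
    rw [h1, norm_smul, Real.norm_of_nonneg (by positivity)]
    have h4 := ((hBx k).le.trans h3)
    calc (k : ℝ) = ((1 / 2 : ℝ) ^ k) ^ n * (k * (2 ^ k) ^ n) := by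
          rw [mul_left_comm, ← mul_pow, ← mul_pow]; norm_num
      _ ≤ _ := by gcongr
  obtain ⟨k, hk⟩ := exists_nat_gt ‖B fun _ => ∑' j, u j‖
  exact absurd (key k) (not_le.2 hk)

/-- The polarization estimate for positive symmetric multilinear mappings. -/
theorem norm_apply_le_of_diag {B : MultilinearMap ℝ (fun _ : Fin n => E) F} (hB : 0 ≤ B)
    (hsymm : ∀ (σ : Equiv.Perm (Fin n)) (v : Fin n → E), B (v ∘ σ) = B v) {K : ℝ}
    (hK : ∀ x : E, ‖x‖ ≤ 1 → ‖B fun _ => x‖ ≤ K) (v : Fin n → E) :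
    ‖B v‖ ≤ K * Real.exp 1 ^ n * ∏ i, ‖v i‖ := by
  have hK0 : 0 ≤ K := (norm_nonneg _).trans (hK 0 (by simp))
  by_cases hv : ∃ i, v i = 0
  · obtain ⟨i, hi⟩ := hv
    rw [B.map_coord_zero i hi, norm_zero]
    positivity
  push Not at hv
  -- After normalising, the mean of the w i lies in the unit ball. Hence n! ‖B w‖ ≤ nⁿ K, and nⁿ/n!
  -- ≤ eⁿ.
  let w : Fin n → E := fun i => ‖v i‖⁻¹ • |v i|
  have hw0 : ∀ i, 0 ≤ w i := fun i => smul_nonneg (by positivity) (abs_nonneg _)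
  have hw1 : ∀ i, ‖w i‖ = 1 := fun i => by
    rw [norm_smul, norm_abs_eq_norm, norm_inv, norm_norm,
      inv_mul_cancel₀ (norm_ne_zero_iff.2 (hv i))]
  have hsum : B (fun _ => ∑ i, w i) = ((n : ℝ) ^ n) • B fun _ => (n : ℝ)⁻¹ • ∑ i, w i := by
    have := B.map_smul_univ (fun _ => (n : ℝ)) fun _ => (n : ℝ)⁻¹ • ∑ i, w i
    simp only [Finset.prod_const, Finset.card_univ, Fintype.card_fin] at this
    rw [← this]
    congr 1
    ext i
    have hn : (n : ℝ) ≠ 0 := Nat.cast_ne_zero.2 i.pos.ne'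
    rw [smul_smul, mul_inv_cancel₀ hn, one_smul]
  have hsum1 : ‖(n : ℝ)⁻¹ • ∑ i, w i‖ ≤ 1 := by
    rw [norm_smul, norm_inv, Real.norm_of_nonneg (Nat.cast_nonneg n)]
    have : ‖∑ i, w i‖ ≤ n := (norm_sum_le _ _).trans (by simp [hw1])
    exact (mul_le_mul_of_nonneg_left this (by positivity)).trans
      (inv_mul_le_one_of_le₀ le_rfl (by positivity))
  have h1 := norm_le_norm_of_nonneg_of_le (smul_nonneg (by positivity) (hB w hw0))
    (factorial_smul_le hsymm hB hw0)
  rw [hsum, norm_smul, norm_smul, Real.norm_of_nonneg (by positivity),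
    Real.norm_of_nonneg (by positivity)] at h1
  have h2 : ‖B w‖ ≤ K * Real.exp 1 ^ n := by
    have h3 : (n : ℝ) ^ n / n.factorial ≤ Real.exp 1 ^ n := by
      rw [← Real.exp_nat_mul, mul_one]
      exact Real.pow_div_factorial_le_exp _ (Nat.cast_nonneg n) n
    have hf : (0 : ℝ) < n.factorial := by positivity
    have h4 : ‖B w‖ ≤ (n : ℝ) ^ n / n.factorial * K := by
      rw [div_mul_eq_mul_div, le_div_iff₀ hf, mul_comm]
      exact h1.trans (mul_le_mul_of_nonneg_left (hK _ hsum1) (by positivity))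
    rw [mul_comm K]
    exact h4.trans (mul_le_mul_of_nonneg_right h3 hK0)
  have h5 : B (fun i => |v i|) = (∏ i, ‖v i‖) • B w := by
    rw [← B.map_smul_univ]
    congr 1
    ext i
    simp only [w]
    rw [smul_smul, mul_inv_cancel₀ (norm_ne_zero_iff.2 (hv i)), one_smul]
  have h6 : ‖B v‖ ≤ ‖B fun i => |v i|‖ := norm_le_norm_of_abs_le (abs_apply_le_of_nonneg hB v)
  refine h6.trans ?_
  rw [h5, norm_smul, Real.norm_of_nonneg (Finset.prod_nonneg fun i _ => norm_nonneg _), mul_comm]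
  exact mul_le_mul_of_nonneg_right h2 (Finset.prod_nonneg fun i _ => norm_nonneg _)

theorem rot_apply_ofReal (A : MultilinearMap ℂ (fun _ : Fin n => Cplx E) (Cplx F)) (θ : ℝ)
    (v : Fin n → E) : (A fun i => Cplx.ofReal (v i)).rot θ = A.realRot θ v := rfl

/-- On real vectors each rotation of A is bounded by B of the absolute values. For general z, expand
re z + i im z in every slot: the powers of i have modulus 1, and the bounds recombine to B (|re z| +
|im z|). -/
theorem IsDominatedBy.modulus_apply_le
    {A : MultilinearMap ℂ (fun _ : Fin n => Cplx E) (Cplx F)}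
    {B : MultilinearMap ℝ (fun _ : Fin n => E) F} (h : A.IsDominatedBy B) (z : Fin n → Cplx E) :
    (A z).modulus ≤ B fun i => |(z i).re| + |(z i).im| := by
  have hreal : ∀ v : Fin n → E, (A fun i => Cplx.ofReal (v i)).modulus ≤ B fun i => |v i| := by
    intro v
    refine Cplx.modulus_le fun θ => ?_
    rw [rot_apply_ofReal]
    exact (le_abs_self _).trans
      (abs_apply_le (fun w hw => abs_le'.2 ⟨h θ w hw, h.neg_le θ w hw⟩) v)
  have hz : z = (fun i => Cplx.ofReal (z i).re) + fun i => Complex.I • Cplx.ofReal (z i).im := by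
    ext i <;> simp [Cplx.ofReal]
  have hB : (B fun i => |(z i).re| + |(z i).im|) = ∑ s : Finset (Fin n),
      B (s.piecewise (fun i => |(z i).re|) fun i => |(z i).im|) := by
    rw [← B.map_add_univ]
    rfl
  conv_lhs => rw [hz, A.map_add_univ]
  rw [hB]
  have h0 : (0 : Cplx F).modulus ≤ 0 := by simpa using (0 : Cplx F).modulus_le_add
  refine (Finset.le_sum_of_subadditive Cplx.modulus h0 Cplx.modulus_add_le _ _).trans ?_
  refine Finset.sum_le_sum fun s _ => ?_
  have hs : A (s.piecewise (fun i => Cplx.ofReal (z i).re) fun i =>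
      Complex.I • Cplx.ofReal (z i).im) = (∏ i, if i ∈ s then (1 : ℂ) else Complex.I) •
        A fun i => Cplx.ofReal (s.piecewise (fun i => (z i).re) (fun i => (z i).im) i) := by
    rw [← A.map_smul_univ]
    congr 1
    funext i
    by_cases hi : i ∈ s <;> simp [hi]
  have hc : ‖∏ i, if i ∈ s then (1 : ℂ) else Complex.I‖ = 1 := by
    rw [norm_prod]
    refine Finset.prod_eq_one fun i _ => ?_
    by_cases hi : i ∈ s <;> simp [hi]
  rw [hs]
  refine (Cplx.modulus_smul_le _ _).trans ?_
  rw [hc, one_smul]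
  refine (hreal _).trans (le_of_eq ?_)
  congr 1
  funext i
  by_cases hi : i ∈ s <;> simp [hi]

theorem IsDominatedBy.norm_apply_le
    {A : MultilinearMap ℂ (fun _ : Fin n => Cplx E) (Cplx F)}
    {B : MultilinearMap ℝ (fun _ : Fin n => E) F} (h : A.IsDominatedBy B) {K : ℝ} (hK0 : 0 ≤ K)
    (hK : ∀ v : Fin n → E, ‖B v‖ ≤ K * ∏ i, ‖v i‖) (z : Fin n → Cplx E) :
    ‖A z‖ ≤ K * 2 ^ n * ∏ i, ‖z i‖ := by
  have h1 : ‖A z‖ ≤ ‖B fun i => |(z i).re| + |(z i).im|‖ :=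
    norm_le_norm_of_nonneg_of_le (Cplx.modulus_nonneg _) (h.modulus_apply_le z)
  refine (h1.trans (hK _)).trans ?_
  have h2 : ∏ i, ‖|(z i).re| + |(z i).im|‖ ≤ ∏ i, 2 * ‖z i‖ := by
    refine Finset.prod_le_prod (fun i _ => norm_nonneg _) fun i _ => ?_
    refine (norm_add_le _ _).trans ?_
    rw [norm_abs_eq_norm, norm_abs_eq_norm, two_mul]
    exact add_le_add (Cplx.norm_re_le _) (Cplx.norm_im_le _)
  rw [Finset.prod_mul_distrib, Finset.prod_const, Finset.card_univ, Fintype.card_fin] at h2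
  rw [mul_assoc]
  exact mul_le_mul_of_nonneg_left h2 hK0

end MultilinearMap

theorem regNorm_le_ofReal_iff {P : Cplx E → Cplx F} {K : ℝ} (hK : 0 ≤ K) :
    regNorm n P ≤ ENNReal.ofReal K ↔ ∀ x : E, ‖x‖ ≤ 1 → ‖polyModulus n P x‖ ≤ K := by
  simp only [regNorm, iSup_le_iff, ← ofReal_norm, ENNReal.ofReal_le_ofReal_iff hK]

/-- The values of the modulus are bounded by those of any dominating multilinear mapping. -/
theorem MultilinearMap.IsDominatedBy.norm_polyModulus_le (hF : IsDedekindComplete F)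
    {A : MultilinearMap ℂ (fun _ : Fin n => Cplx E) (Cplx F)}
    {P : Cplx E → Cplx F} (hhom : IsHomPoly n P) (hP : ∀ z, P z = A fun _ => z)
    {B : MultilinearMap ℝ (fun _ : Fin n => E) F} (h : A.IsDominatedBy B) (x : E) :
    ‖polyModulus n P x‖ ≤ ‖B fun _ => |x|‖ := by
  have hQ := (h.isRegularPoly hhom hP).isPolyModulus_polyModulus hF
  -- A need not be symmetric, as it will be a coefficient of a recentred series; a symmetric
  -- representative comes from `hhom`.
  obtain ⟨A', hA', hP'⟩ := hhom
  obtain ⟨C, hC, hC0, hCP⟩ := h.polyLE_of_isPolyModulus hP hQ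
  obtain ⟨D, hD, hAD, hDP⟩ := hQ.exists_multilinear hA' hP'
  have h1 : |polyModulus n P x| ≤ polyModulus n P |x| := by
    rw [hDP, hDP]
    exact MultilinearMap.abs_apply_le_of_nonneg hAD.nonneg _
  refine norm_le_norm_of_abs_le (h1.trans ?_)
  have h2 := hC0 (fun _ => |x|) fun _ => abs_nonneg x
  rwa [← hCP, Pi.sub_apply, sub_nonneg] at h2

/-- Positive polynomials are automatically bounded on the unit ball. This covers the finitely many
Taylor coefficients that a limsup does not control. -/
theorem IsRegularPoly.exists_regNorm_le (hF : IsDedekindComplete F) {P : Cplx E → Cplx F}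
    (hP : IsRegularPoly n P) : ∃ K : ℝ, 0 ≤ K ∧ regNorm n P ≤ ENNReal.ofReal K := by
  have hQ := hP.isPolyModulus_polyModulus hF
  obtain ⟨A, hA, hPA⟩ := hP.1
  obtain ⟨D, hD, hAD, hDP⟩ := hQ.exists_multilinear hA hPA
  obtain ⟨K, hK⟩ := MultilinearMap.exists_bound_diag hAD.nonneg
  have hK0 : 0 ≤ K := (norm_nonneg _).trans (hK 0 (by simp))
  exact ⟨K, hK0, (regNorm_le_ofReal_iff hK0).2 fun x hx => by rw [hDP]; exact hK x hx⟩

end NormEstimates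

/-! ### Domination of power series and change of origin -/

section ChangeOrigin

variable {E F : Type*}
  [NormedAddCommGroup E] [NormedSpace ℝ E] [Lattice E] [HasSolidNorm E]
  [IsOrderedAddMonoid E] [IsOrderedModule ℝ E] [CompleteSpace E]
  [NormedAddCommGroup F] [NormedSpace ℝ F] [Lattice F] [HasSolidNorm F]
  [IsOrderedAddMonoid F] [IsOrderedModule ℝ F] [CompleteSpace F]

namespace Cplx

/-- The additive mapping `z ↦ cos θ re z + sin θ im z`. -/
noncomputable def rotHom (θ : ℝ) : Cplx F →+ F where
  toFun z := z.rot θ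
  map_zero' := by simp [rot]
  map_add' z w := by simp only [rot, add_re, add_im]; module

theorem rotHom_apply (θ : ℝ) (z : Cplx F) : rotHom θ z = z.rot θ := rfl

theorem continuous_rotHom (θ : ℝ) : Continuous (rotHom θ : Cplx F →+ F) := by
  refine AddMonoidHomClass.continuous_of_bound _ 1 fun z => ?_
  rw [one_mul, rotHom_apply]
  refine norm_le_norm_of_abs_le (abs_le'.2 ⟨z.rot_le_modulus θ, ?_⟩)
  refine le_trans (le_of_eq ?_) (z.rot_le_modulus (θ + Real.pi))
  simp only [rot, Real.cos_add_pi, Real.sin_add_pi]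
  module

end Cplx

open FormalMultilinearSeries

/-- The term is the coefficient of degree k + l with a in the slots of s and v in the others.
`modulus_apply_le` turns a into |re a| + |im a| and leaves the positive v unchanged. -/
theorem modulus_changeOriginSeriesTerm_le {p : FormalMultilinearSeries ℂ (Cplx E) (Cplx F)}
    {B : FormalMultilinearSeries ℝ E F}
    (h : ∀ m, (p m).toMultilinearMap.IsDominatedBy (B m).toMultilinearMap) (a : Cplx E)
    (k l : ℕ) (s : Finset (Fin (k + l))) (hs : s.card = l) {v : Fin k → E} (hv : ∀ i, 0 ≤ v i) :
    (p.changeOriginSeriesTerm k l s hs (fun _ => a) fun i => Cplx.ofReal (v i)).modulus ≤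
      B.changeOriginSeriesTerm k l s hs (fun _ => |a.re| + |a.im|) v := by
  simp only [changeOriginSeriesTerm, ContinuousMultilinearMap.curryFinFinset_apply]
  refine ((h (k + l)).modulus_apply_le _).trans (le_of_eq ?_)
  rw [ContinuousMultilinearMap.coe_coe]
  congr 1
  funext i
  rcases (finSumEquivOfFinset hs
    (by rw [Finset.card_compl, Fintype.card_fin, hs, add_tsub_cancel_right])).symm i with j | j
  · rfl
  · simp [Cplx.ofReal, abs_of_nonneg (hv j)]

theorem hasSum_changeOrigin_apply {𝕜 X Y : Type*} [NontriviallyNormedField 𝕜]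
    [NormedAddCommGroup X] [NormedSpace 𝕜 X] [NormedAddCommGroup Y] [NormedSpace 𝕜 Y]
    [CompleteSpace Y] (p : FormalMultilinearSeries 𝕜 X Y) {a : X} (ha : ‖a‖ₑ < p.radius) (k : ℕ)
    (v : Fin k → X) :
    HasSum (fun l => ∑ s : { s : Finset (Fin (k + l)) // s.card = l },
      p.changeOriginSeriesTerm k l s s.2 (fun _ => a) v) (p.changeOrigin a k v) := by
  have h := (p.hasFPowerSeriesOnBall_changeOrigin k (bot_le.trans_lt ha)).hasSum
    (mem_eball_zero_iff.2 ha)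
  rw [zero_add] at h
  have h' := ContinuousMultilinearMap.hasSum_eval h v
  simpa only [changeOriginSeries, _root_.sum_apply] using h'

/-- Domination of power series is preserved when the origin is moved to `a` and to
`|re a| + |im a|`, respectively. -/
theorem isDominatedBy_changeOrigin {p : FormalMultilinearSeries ℂ (Cplx E) (Cplx F)}
    {B : FormalMultilinearSeries ℝ E F}
    (h : ∀ m, (p m).toMultilinearMap.IsDominatedBy (B m).toMultilinearMap) {a : Cplx E}
    (ha : ‖a‖ₑ < p.radius) (hb : ‖|a.re| + |a.im|‖ₑ < B.radius) (k : ℕ) :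
    (p.changeOrigin a k).toMultilinearMap.IsDominatedBy
      (B.changeOrigin (|a.re| + |a.im|) k).toMultilinearMap := by
  intro θ v hv
  -- A rotation is additive and continuous, so it passes through the infinite sum and the terms can
  -- be compared one by one.
  have h1 := (hasSum_changeOrigin_apply p ha k fun i => Cplx.ofReal (v i)).map
    (Cplx.rotHom θ) (Cplx.continuous_rotHom θ)
  have h2 := hasSum_changeOrigin_apply B hb k v
  refine hasSum_le (fun l => ?_) h1 h2
  rw [Function.comp_apply, map_sum]
  exact Finset.sum_le_sum fun s _ => (Cplx.rot_le_modulus _ θ).trans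
    (modulus_changeOriginSeriesTerm_le h a k l s s.2 hv)

end ChangeOrigin

/-! ### Growth of the Taylor coefficients -/

section Growth

variable {E F : Type*}
  [NormedAddCommGroup E] [NormedSpace ℝ E] [Lattice E] [HasSolidNorm E]
  [IsOrderedAddMonoid E] [IsOrderedModule ℝ E] [CompleteSpace E]
  [NormedAddCommGroup F] [NormedSpace ℝ F] [Lattice F] [HasSolidNorm F]
  [IsOrderedAddMonoid F] [IsOrderedModule ℝ F] [CompleteSpace F]

/-- The Taylor coefficients of `f` at `z` as symmetric multilinear mappings. -/
noncomputable def taylorSeries (f : Cplx E → Cplx F) (z : Cplx E) :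
    FormalMultilinearSeries ℂ (Cplx E) (Cplx F) :=
  fun m => ((m.factorial : ℂ)⁻¹) • iteratedFDeriv ℂ m f z

theorem taylorSeries_diag (f : Cplx E → Cplx F) (z w : Cplx E) (m : ℕ) :
    taylorPoly m f z w = (taylorSeries f z m).toMultilinearMap fun _ => w := rfl

theorem taylorSeries_symm {f : Cplx E → Cplx F} {z : Cplx E} (hf : AnalyticAt ℂ f z) (m : ℕ)
    (σ : Equiv.Perm (Fin m)) (v : Fin m → Cplx E) :
    (taylorSeries f z m).toMultilinearMap (v ∘ σ) = (taylorSeries f z m).toMultilinearMap v := by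
  change (m.factorial : ℂ)⁻¹ • iteratedFDeriv ℂ m f z (v ∘ σ) =
    (m.factorial : ℂ)⁻¹ • iteratedFDeriv ℂ m f z v
  rw [hf.contDiffAt.iteratedFDeriv_comp_perm]

theorem isHomPoly_taylorPoly {f : Cplx E → Cplx F} {z : Cplx E} (hf : AnalyticAt ℂ f z) (m : ℕ) :
    IsHomPoly m (taylorPoly m f z) :=
  ⟨_, taylorSeries_symm hf m, fun w => taylorSeries_diag f z w m⟩

theorem taylorPoly_eq_of_hasFPowerSeriesOnBall {f : Cplx E → Cplx F} {z : Cplx E}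
    {p : FormalMultilinearSeries ℂ (Cplx E) (Cplx F)} {r : ℝ≥0∞}
    (hp : HasFPowerSeriesOnBall f p z r) (m : ℕ) (w : Cplx E) :
    taylorPoly m f z w = p m fun _ => w := by
  rw [taylorPoly, ← hp.factorial_smul, ← Nat.cast_smul_eq_nsmul ℂ, smul_smul,
    inv_mul_cancel₀, one_smul]
  exact_mod_cast m.factorial_ne_zero

theorem taylorPoly_congr {f g : Cplx E → Cplx F} {z : Cplx E} (h : f =ᶠ[𝓝 z] g) (m : ℕ) :
    taylorPoly m f z = taylorPoly m g z := by
  ext1 w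
  rw [taylorPoly, taylorPoly, (h.iteratedFDeriv ℂ m).eq_of_nhds]

theorem RegularlyHolomorphicAt.exists_geometric_bound (hF : IsDedekindComplete F)
    {f : Cplx E → Cplx F} {z : Cplx E} (h : RegularlyHolomorphicAt f z) :
    ∃ C ρ : ℝ, 0 < C ∧ 0 < ρ ∧
      ∀ m : ℕ, regNorm m (taylorPoly m f z) ≤ ENNReal.ofReal (C * ρ ^ m) := by
  obtain ⟨hreg, hlim⟩ := h
  obtain ⟨K, hK, -⟩ := ENNReal.lt_iff_exists_nnreal_btwn.1 hlim
  obtain ⟨N, hN⟩ := eventually_atTop.1 (eventually_lt_of_limsup_lt hK)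
  choose κ hκ0 hκ using fun m => (hreg m).exists_regNorm_le hF
  have hS : 0 ≤ ∑ j ∈ Finset.range (N + 1), κ j := Finset.sum_nonneg fun j _ => hκ0 j
  have hK0 : (0 : ℝ) ≤ K := K.2
  refine ⟨1 + ∑ j ∈ Finset.range (N + 1), κ j, 1 + K, by positivity, by positivity, fun m => ?_⟩
  -- The threshold N + 1 rather than N excludes m = 0, where the exponent 1 / m is 0 and the root
  -- cannot be undone.
  by_cases hm : m < N + 1
  · refine (hκ m).trans (ENNReal.ofReal_le_ofReal ?_)
    have h1 : κ m ≤ ∑ j ∈ Finset.range (N + 1), κ j :=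
      Finset.single_le_sum (fun j _ => hκ0 j) (Finset.mem_range.2 hm)
    have h2 : (1 : ℝ) ≤ (1 + K) ^ m := one_le_pow₀ (by linarith)
    nlinarith
  · push Not at hm
    have hm0 : (m : ℝ) ≠ 0 := Nat.cast_ne_zero.2 (by omega)
    have h1 := (hN m (by omega)).le
    have h2 : regNorm m (taylorPoly m f z) ≤ (K : ℝ≥0∞) ^ m := by
      have h3 := pow_le_pow_left' h1 m
      rwa [← ENNReal.rpow_natCast, ← ENNReal.rpow_mul, one_div, inv_mul_cancel₀ hm0,
        ENNReal.rpow_one] at h3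
    refine h2.trans ?_
    rw [← ENNReal.ofReal_coe_nnreal, ← ENNReal.ofReal_pow hK0]
    refine ENNReal.ofReal_le_ofReal ?_
    have h4 : (K : ℝ) ^ m ≤ (1 + K) ^ m := pow_le_pow_left₀ hK0 (by linarith) m
    have h5 : (0 : ℝ) ≤ (1 + K) ^ m := by positivity
    nlinarith

theorem regularlyHolomorphicAt_of_geometric_bound {f : Cplx E → Cplx F} {z : Cplx E} {C r : ℝ}
    (hC : 0 < C) (hr : 0 < r) (hreg : ∀ m, IsRegularPoly m (taylorPoly m f z))
    (h : ∀ m : ℕ, regNorm m (taylorPoly m f z) ≤ ENNReal.ofReal (C * r ^ m)) :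
    RegularlyHolomorphicAt f z := by
  -- With max C 1 ≥ 1 the constant is absorbed: C ≤ (max C 1)^m for m ≥ 1.
  refine ⟨hreg, lt_of_le_of_lt (limsup_le_of_le (a := ENNReal.ofReal (max C 1 * r)) ?_ ?_)
    ENNReal.ofReal_lt_top⟩
  · isBoundedDefault
  · filter_upwards [eventually_ge_atTop 1] with m hm
    have hm0 : (m : ℝ) ≠ 0 := Nat.cast_ne_zero.2 (by omega)
    have h1 : C * r ^ m ≤ (max C 1 * r) ^ m := by
      rw [mul_pow]
      refine mul_le_mul_of_nonneg_right ?_ (by positivity)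
      exact (le_max_left C 1).trans (le_self_pow₀ (le_max_right C 1) (by omega))
    have h2 := (h m).trans (ENNReal.ofReal_le_ofReal h1)
    rw [ENNReal.ofReal_pow (by positivity)] at h2
    calc regNorm m (taylorPoly m f z) ^ (1 / (m : ℝ))
        ≤ (ENNReal.ofReal (max C 1 * r) ^ m) ^ (1 / (m : ℝ)) :=
          ENNReal.rpow_le_rpow h2 (by positivity)
      _ = ENNReal.ofReal (max C 1 * r) := by
          rw [← ENNReal.rpow_natCast, ← ENNReal.rpow_mul, mul_one_div_cancel hm0,
            ENNReal.rpow_one]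

theorem eventually_summable_of_geometric_bound {f : Cplx E → Cplx F} {z : Cplx E} {C r : ℝ}
    (hr : 0 < r)
    (h : ∀ (m : ℕ) (x : E), ‖polyModulus m (taylorPoly m f z) x‖ ≤ C * r ^ m * ‖x‖ ^ m) :
    ∀ᶠ w in 𝓝 z, Summable fun m : ℕ => polyModulus m (taylorPoly m f z) (w - z).modulus := by
  filter_upwards [ball_mem_nhds z (inv_pos.2 hr)] with w hw
  rw [mem_ball, dist_eq_norm] at hw
  have hlt : r * ‖w - z‖ < 1 := by
    rw [mul_comm]
    exact (lt_inv_mul_iff₀' hr).1 (by simpa using hw)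
  refine Summable.of_norm_bounded
    ((summable_geometric_of_lt_one (by positivity) hlt).mul_left C) fun m => (h m _).trans ?_
  rw [mul_pow, ← mul_assoc]
  rfl

theorem RegularlyHolomorphicOn.congr {f g : Cplx E → Cplx F} {V W : Set (Cplx E)}
    (hg : RegularlyHolomorphicOn g W) (hV : IsOpen V) (hVW : V ⊆ W) (h : EqOn f g V) :
    RegularlyHolomorphicOn f V := by
  have hev : ∀ z ∈ V, f =ᶠ[𝓝 z] g := fun z hz => h.eventuallyEq_of_mem (hV.mem_nhds hz)
  refine ⟨fun z hz => (hg.holomorphic z (hVW hz)).congr (hev z hz).symm, fun z hz m => ?_,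
    fun z hz => ?_⟩
  · rw [taylorPoly_congr (hev z hz)]
    exact hg.regular z (hVW hz) m
  · simp only [taylorPoly_congr (hev z hz)]
    exact hg.convergent z (hVW hz)

theorem RegularlyHolomorphicAt.congr {f g : Cplx E → Cplx F} {z : Cplx E}
    (hg : RegularlyHolomorphicAt g z) (h : f =ᶠ[𝓝 z] g) : RegularlyHolomorphicAt f z := by
  simpa only [RegularlyHolomorphicAt, taylorPoly_congr h] using hg

end Growth

/-! ### The continuation given by the Taylor series -/

section Continuation

variable {E F : Type*}
  [NormedAddCommGroup E] [NormedSpace ℝ E] [Lattice E] [HasSolidNorm E]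
  [IsOrderedAddMonoid E] [IsOrderedModule ℝ E] [CompleteSpace E]
  [NormedAddCommGroup F] [NormedSpace ℝ F] [Lattice F] [HasSolidNorm F]
  [IsOrderedAddMonoid F] [IsOrderedModule ℝ F] [CompleteSpace F]

open FormalMultilinearSeries

theorem FormalMultilinearSeries.ofReal_inv_le_radius {𝕜 X Y : Type*} [NontriviallyNormedField 𝕜]
    [NormedAddCommGroup X] [NormedSpace 𝕜 X] [NormedAddCommGroup Y] [NormedSpace 𝕜 Y]
    {p : FormalMultilinearSeries 𝕜 X Y} {C r : ℝ} (hr : 0 < r) (h : ∀ m, ‖p m‖ ≤ C * r ^ m) :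
    ENNReal.ofReal r⁻¹ ≤ p.radius := by
  refine p.le_radius_of_bound C fun m => ?_
  rw [Real.coe_toNNReal _ (inv_nonneg.2 hr.le), inv_pow, ← div_eq_mul_inv,
    div_le_iff₀ (by positivity)]
  exact h m

/-- Geometric bounds for the regular norms of the Taylor coefficients of `f` at `z` give a
dominating real power series. -/
theorem exists_dominating_series (hF : IsDedekindComplete F) {f : Cplx E → Cplx F} {z : Cplx E}
    (hf : AnalyticAt ℂ f z) (hreg : ∀ m, IsRegularPoly m (taylorPoly m f z)) {C ρ : ℝ}
    (hC : 0 < C) (hρ : 0 < ρ)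
    (hb : ∀ m : ℕ, regNorm m (taylorPoly m f z) ≤ ENNReal.ofReal (C * ρ ^ m)) :
    ∃ B : FormalMultilinearSeries ℝ E F,
      (∀ m, (taylorSeries f z m).toMultilinearMap.IsDominatedBy (B m).toMultilinearMap) ∧
      ENNReal.ofReal (Real.exp 1 * ρ)⁻¹ ≤ B.radius ∧
      ENNReal.ofReal (2 * Real.exp 1 * ρ)⁻¹ ≤ (taylorSeries f z).radius := by
  have hex : ∀ m, ∃ B : MultilinearMap ℝ (fun _ : Fin m => E) F,
      (taylorSeries f z m).toMultilinearMap.IsDominatedBy B ∧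
      ∀ v : Fin m → E, ‖B v‖ ≤ C * (Real.exp 1 * ρ) ^ m * ∏ i, ‖v i‖ := by
    intro m
    obtain ⟨B, hB, hdom, hQ⟩ := ((hreg m).isPolyModulus_polyModulus hF).exists_multilinear
      (taylorSeries_symm hf m) fun w => taylorSeries_diag f z w m
    refine ⟨B, hdom, fun v => ?_⟩
    have h1 := (regNorm_le_ofReal_iff (by positivity)).1 (hb m)
    simp only [hQ] at h1
    have h2 := MultilinearMap.norm_apply_le_of_diag hdom.nonneg hB h1 v
    rwa [mul_assoc C, ← mul_pow, mul_comm ρ] at h2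
  choose B hdom hB using hex
  -- Both radii come from geometric bounds: C (eρ)^m after polarization, and C (2eρ)^m after passing
  -- to complex arguments.
  refine ⟨fun m => (B m).mkContinuous _ (hB m), hdom,
    ofReal_inv_le_radius (C := C) (by positivity) fun m =>
      (B m).mkContinuous_norm_le (by positivity) (hB m),
    ofReal_inv_le_radius (C := C) (by positivity) fun m =>
      ContinuousMultilinearMap.opNorm_le_bound (by positivity) fun w => ?_⟩
  have h := (hdom m).norm_apply_le (by positivity) (hB m) w
  rwa [mul_assoc C, ← mul_pow, mul_comm _ (2 : ℝ), ← mul_assoc (2 : ℝ)] at h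

/-- A holomorphic function whose power series at `z` is dominated by a convergent real power
series has regular Taylor coefficients at nearby points, with geometrically bounded moduli. -/
theorem exists_polyModulus_bound (hF : IsDedekindComplete F) {g : Cplx E → Cplx F}
    {z a : Cplx E} {p : FormalMultilinearSeries ℂ (Cplx E) (Cplx F)}
    {B : FormalMultilinearSeries ℝ E F} {R : ℝ≥0∞} (hp : HasFPowerSeriesOnBall g p z R)
    (hdom : ∀ m, (p m).toMultilinearMap.IsDominatedBy (B m).toMultilinearMap) (ha : ‖a‖ₑ < R)
    (hb : ‖|a.re| + |a.im|‖ₑ < B.radius) :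
    ∃ C r : ℝ, 0 < C ∧ 0 < r ∧ ∀ m, IsRegularPoly m (taylorPoly m g (z + a)) ∧
      ∀ x : E, ‖polyModulus m (taylorPoly m g (z + a)) x‖ ≤ C * r ^ m * ‖x‖ ^ m := by
  have hq := hp.changeOrigin ha
  have hdom' := isDominatedBy_changeOrigin hdom (ha.trans_le hp.r_le) hb
  have hpos : 0 < (B.changeOrigin (|a.re| + |a.im|)).radius :=
    (tsub_pos_of_lt hb).trans_le B.changeOrigin_radius
  obtain ⟨C, r, hC, hr, hbd⟩ := le_mul_pow_of_radius_pos _ hpos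
  refine ⟨C, r, hC, hr, fun m => ?_⟩
  have hhom := isHomPoly_taylorPoly hq.analyticAt m
  have hdiag := taylorPoly_eq_of_hasFPowerSeriesOnBall hq m
  refine ⟨(hdom' m).isRegularPoly hhom hdiag, fun x => ?_⟩
  refine ((hdom' m).norm_polyModulus_le hF hhom hdiag x).trans ?_
  refine (ContinuousMultilinearMap.le_opNorm _ _).trans ?_
  rw [Finset.prod_const, Finset.card_univ, Fintype.card_fin, norm_abs_eq_norm]
  exact mul_le_mul_of_nonneg_right (hbd m) (by positivity)

/-- The function g is the sum of the Taylor series. For a = z - z₀ in the ball, ‖|re a| + |im a|‖ ≤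
2‖a‖ < (eρ)⁻¹, so the dominating series can be recentred too. -/
theorem exists_regularlyHolomorphic_continuation (hF : IsDedekindComplete F)
    {f : Cplx E → Cplx F} {z₀ : Cplx E} (hf : AnalyticAt ℂ f z₀)
    (hreg : ∀ m, IsRegularPoly m (taylorPoly m f z₀)) {C ρ : ℝ} (hC : 0 < C) (hρ : 0 < ρ)
    (hb : ∀ m : ℕ, regNorm m (taylorPoly m f z₀) ≤ ENNReal.ofReal (C * ρ ^ m)) :
    ∃ g : Cplx E → Cplx F,
      (∀ z ∈ ball z₀ (2 * Real.exp 1 * ρ)⁻¹,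
        HasSum (fun m : ℕ => taylorPoly m f z₀ (z - z₀)) (g z)) ∧
      RegularlyHolomorphicOn g (ball z₀ (2 * Real.exp 1 * ρ)⁻¹) ∧
      (∀ z ∈ ball z₀ (2 * Real.exp 1 * ρ)⁻¹, RegularlyHolomorphicAt g z) ∧ f =ᶠ[𝓝 z₀] g := by
  obtain ⟨B, hdom, hBr, hpr⟩ := exists_dominating_series hF hf hreg hC hρ hb
  set p := taylorSeries f z₀ with hpdef
  have hR : 0 < (2 * Real.exp 1 * ρ)⁻¹ := by positivity
  have hR' : 0 < ENNReal.ofReal (2 * Real.exp 1 * ρ)⁻¹ := ENNReal.ofReal_pos.2 hR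
  have hp : HasFPowerSeriesOnBall (fun z => p.sum (z - z₀)) p z₀
      (ENNReal.ofReal (2 * Real.exp 1 * ρ)⁻¹) := by
    simpa using ((p.hasFPowerSeriesOnBall (hR'.trans_le hpr)).mono hR' hpr).comp_sub z₀
  have hbound : ∀ z ∈ ball z₀ (2 * Real.exp 1 * ρ)⁻¹, ∃ C r : ℝ, 0 < C ∧ 0 < r ∧
      ∀ m, IsRegularPoly m (taylorPoly m (fun z => p.sum (z - z₀)) z) ∧ ∀ x : E,
        ‖polyModulus m (taylorPoly m (fun z => p.sum (z - z₀)) z) x‖ ≤ C * r ^ m * ‖x‖ ^ m := by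
    intro z hz
    rw [mem_ball, dist_eq_norm] at hz
    have h := exists_polyModulus_bound hF hp hdom (a := z - z₀)
      (by rw [← ofReal_norm]; exact (ENNReal.ofReal_lt_ofReal_iff hR).2 hz)
      (by
        refine lt_of_lt_of_le ?_ hBr
        rw [← ofReal_norm, ENNReal.ofReal_lt_ofReal_iff (by positivity)]
        calc ‖|(z - z₀).re| + |(z - z₀).im|‖ ≤ ‖(z - z₀).re‖ + ‖(z - z₀).im‖ := by
              simpa [norm_abs_eq_norm] using norm_add_le |(z - z₀).re| |(z - z₀).im|
          _ ≤ ‖z - z₀‖ + ‖z - z₀‖ := add_le_add (Cplx.norm_re_le _) (Cplx.norm_im_le _)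
          _ < (2 * Real.exp 1 * ρ)⁻¹ + (2 * Real.exp 1 * ρ)⁻¹ := add_lt_add hz hz
          _ = (Real.exp 1 * ρ)⁻¹ := by
              rw [mul_assoc, mul_inv]
              ring)
    rwa [add_sub_cancel] at h
  refine ⟨fun z => p.sum (z - z₀), fun z hz => ?_, ⟨?_, fun z hz m => ?_, fun z hz => ?_⟩,
    fun z hz => ?_, ?_⟩
  · rw [mem_ball, dist_eq_norm] at hz
    refine p.hasSum (mem_eball_zero_iff.2 (lt_of_lt_of_le ?_ hpr))
    rw [← ofReal_norm]
    exact (ENNReal.ofReal_lt_ofReal_iff hR).2 hz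
  · rw [← Metric.eball_ofReal]
    exact hp.analyticOnNhd
  · obtain ⟨C, r, -, -, h⟩ := hbound z hz
    exact (h m).1
  · obtain ⟨C, r, -, hr, h⟩ := hbound z hz
    exact eventually_summable_of_geometric_bound hr fun m => (h m).2
  · obtain ⟨C, r, hC, hr, h⟩ := hbound z hz
    refine regularlyHolomorphicAt_of_geometric_bound hC hr (fun m => (h m).1) fun m => ?_
    refine (regNorm_le_ofReal_iff (by positivity)).2 fun x hx => ((h m).2 x).trans ?_
    exact mul_le_of_le_one_right (by positivity) (pow_le_one₀ (norm_nonneg x) hx)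
  · obtain ⟨q, r, hq⟩ := hf
    filter_upwards [Metric.eball_mem_nhds z₀ hq.r_pos] with z hz
    have hz' : z - z₀ ∈ Metric.eball (0 : Cplx E) r := by
      rwa [mem_eball_zero_iff, ← edist_eq_enorm_sub]
    have h := hq.hasSum_iteratedFDeriv hz'
    rw [add_sub_cancel] at h
    exact h.tsum_eq.symm

end Continuation

theorem proposition4p1 {E F : Type*}
    [NormedAddCommGroup E] [NormedSpace ℝ E] [Lattice E] [HasSolidNorm E]
    [IsOrderedAddMonoid E] [IsOrderedModule ℝ E] [CompleteSpace E]
    [NormedAddCommGroup F] [NormedSpace ℝ F] [Lattice F] [HasSolidNorm F]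
    [IsOrderedAddMonoid F] [IsOrderedModule ℝ F] [CompleteSpace F]
    (hF : IsDedekindComplete F)
    (U : Set (Cplx E)) (hU : IsOpen U) (f : Cplx E → Cplx F) (hf : AnalyticOnNhd ℂ f U)
    (z₀ : Cplx E) (hz₀ : z₀ ∈ U) (hreg : RegularlyHolomorphicAt f z₀) :
    -- `f` is regularly holomorphic in some neighbourhood of `z₀`
    (∃ V ⊆ U, IsOpen V ∧ z₀ ∈ V ∧ RegularlyHolomorphicOn f V ∧
      ∀ z ∈ V, RegularlyHolomorphicAt f z) ∧
    -- the regular norms of the Taylor coefficients at `z₀` have a geometric bound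
    (∃ C ρ : ℝ, 0 < C ∧ 0 < ρ ∧
      ∀ m : ℕ, regNorm m (taylorPoly m f z₀) ≤ ENNReal.ofReal (C * ρ ^ m)) ∧
    -- every such bound gives the radius `(2 e ρ)⁻¹`
    ∀ C ρ : ℝ, 0 < C → 0 < ρ →
      (∀ m : ℕ, regNorm m (taylorPoly m f z₀) ≤ ENNReal.ofReal (C * ρ ^ m)) →
      -- if the ball lies in the domain of `f`
      (ball z₀ (2 * Real.exp 1 * ρ)⁻¹ ⊆ U →
        RegularlyHolomorphicOn f (ball z₀ (2 * Real.exp 1 * ρ)⁻¹) ∧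
        ∀ z ∈ ball z₀ (2 * Real.exp 1 * ρ)⁻¹, RegularlyHolomorphicAt f z) ∧
      -- in general: the Taylor series continues `f` to the whole ball
      ∃ g : Cplx E → Cplx F,
        (∀ z ∈ ball z₀ (2 * Real.exp 1 * ρ)⁻¹,
          HasSum (fun m : ℕ => taylorPoly m f z₀ (z - z₀)) (g z)) ∧
        RegularlyHolomorphicOn g (ball z₀ (2 * Real.exp 1 * ρ)⁻¹) ∧
        (∀ z ∈ ball z₀ (2 * Real.exp 1 * ρ)⁻¹, RegularlyHolomorphicAt g z) ∧
        EqOn f g (connectedComponentIn (U ∩ ball z₀ (2 * Real.exp 1 * ρ)⁻¹) z₀) := by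
  have hfz := hf z₀ hz₀
  refine ⟨?_, hreg.exists_geometric_bound hF, fun C ρ hC hρ hb => ?_⟩
  · obtain ⟨C, ρ, hC, hρ, hb⟩ := hreg.exists_geometric_bound hF
    obtain ⟨g, -, hg, hg', hfg⟩ :=
      exists_regularlyHolomorphic_continuation hF hfz hreg.1 hC hρ hb
    -- V is chosen inside the set where f and g agree near `z₀`, so no connectedness is needed here.
    have hnhds : {z | f z = g z} ∩ (U ∩ ball z₀ (2 * Real.exp 1 * ρ)⁻¹) ∈ 𝓝 z₀ :=
      inter_mem hfg (inter_mem (hU.mem_nhds hz₀) (ball_mem_nhds _ (by positivity)))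
    obtain ⟨V, hV, hVo, hz₀V⟩ := _root_.mem_nhds_iff.1 hnhds
    have hfgV : EqOn f g V := fun z hz => (hV hz).1
    have hVB : V ⊆ ball z₀ (2 * Real.exp 1 * ρ)⁻¹ := fun z hz => (hV hz).2.2
    exact ⟨V, fun z hz => (hV hz).2.1, hVo, hz₀V, hg.congr hVo hVB hfgV, fun z hz =>
      (hg' z (hVB hz)).congr (hfgV.eventuallyEq_of_mem (hVo.mem_nhds hz))⟩
  · obtain ⟨g, hsum, hg, hg', hfg⟩ :=
      exists_regularlyHolomorphic_continuation hF hfz hreg.1 hC hρ hb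
    have hz₀B : z₀ ∈ ball z₀ (2 * Real.exp 1 * ρ)⁻¹ := mem_ball_self (by positivity)
    refine ⟨fun hBU => ?_, g, hsum, hg, hg', ?_⟩
    · have hfgB : EqOn f g (ball z₀ (2 * Real.exp 1 * ρ)⁻¹) :=
        -- Identity theorem on the ball, which is convex and hence connected.
        (hf.mono hBU).eqOn_of_preconnected_of_eventuallyEq hg.holomorphic
          (convex_ball _ _).isPreconnected hz₀B hfg
      exact ⟨hg.congr isOpen_ball Subset.rfl hfgB, fun z hz =>
        (hg' z hz).congr (hfgB.eventuallyEq_of_mem (isOpen_ball.mem_nhds hz))⟩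
    · have hsub := connectedComponentIn_subset (U ∩ ball z₀ (2 * Real.exp 1 * ρ)⁻¹) z₀
      exact (hf.mono fun z hz => (hsub hz).1).eqOn_of_preconnected_of_eventuallyEq
        (hg.holomorphic.mono fun z hz => (hsub hz).2) isPreconnected_connectedComponentIn
        (mem_connectedComponentIn ⟨hz₀, hz₀B⟩) hfg
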